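/- **Setting.** There are $N$ agents; agent $i$ either works ($a_i=1$), at cost $c_i>0$, or shirks ($a_i=0$), which yields $-x$. When $n$ agents work, a project succeeds with probability $q(n)\in[0,1]$, where $q(n+1)>q(n)$ for $0\le n\le N-1$. A principal promises a reward $v_i\in\mathbb R$ to each agent $i$, paid if and only if the project succeeds (independently of $i$'s own action). The state $x$ is drawn from a positive continuous density $g$ on $[\underline X,\overline X]$; each agent observes only $x_i^\varepsilon=x+\varepsilon\eta_i$, where $\varepsilon>0$ and the $\eta_i$ are i.i.d., independent of $x$, with a density $f$ that is continuous on, and has support, $[-1/2,1/2]$. A strategy $p_i$ maps signals to probabilities of working; $p^{X}$ is the strategy vector in which every agent works if and only if his signal is at least $X$. A Bayesian Nash equilibrium is a strategy vector in which every agent's choice at every signal in $(\underline X-\varepsilon/2,\overline X+\varepsilon/2)$ is a best response under his posterior. Rewards $v=(v_i)$ *implement* $p^{X}$ (at noise scale $\varepsilon$) if $p^X$ is a Bayesian Nash equilibrium and every Bayesian Nash equilibrium agrees with $p^X$ at all signals other than $X$. Put $\bar q:=\sum_{n=0}^{N-1}\frac{q(n+1)-q(n)}{N}$ and let $\tilde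 x\in(\underline X,\overline X)$. **Proposition.** 1. The rewards that implement $p^{\tilde x}$ are given, as $\varepsilon\to0$, by $\bar q\cdot\tilde v_i=c_i-\tilde x$: for every $\delta>0$ there is $\varepsilon_0>0$ such that for all $0<\varepsilon<\varepsilon_0$, every reward vector $\tilde v$ that implements $p^{\tilde x}$ satisfies $|\bar q\,\tilde v_i-(c_i-\tilde x)|<\delta$ for all $i$. 2. For every $\varepsilon>0$, at most one reward vector implements $p^{\tilde x}$. 3. Symmetric agents receive identical rewards: for every $\varepsilon>0$, if $\tilde v$ implements $p^{\tilde x}$ and $c_i=c_j$, then $\tilde v_i=\tilde v_j$. 4. Suppose moreover that there are strategic complementarities, i.e. $q(n+1)-q(n)\le q(n+2)-q(n+1)$ for $0\le n\le N-2$ and $\tilde x<c_i$ for all $i$ (so that the rewards are positive); that the dominance regions lie inside the state space, i.e. with $v_i^*=(c_i-\tilde x)/\bar q$ one has $\underline X<c_i-v_i^*(q(N)-q(N-1))$ and $c_i-v_i^*(q(1)-q(0))<\overline X$ for all $i$; and that $g$ is continuously differentiable on $[\underline X,\overline X]$. Then for all sufficiently small $\varepsilon>0$ there is a (by 2, unique)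 reward vector that implements $p^{\tilde x}$. -/

import Mathlib

open MeasureTheory Set Filter Topology

noncomputable section

/-- The data of a principal-agent problem with `N` agents who privately work or shirk on a common
project, in the global-games information environment. -/
structure PrincipalAgent (N : ℕ) where
  /-- cost of working of each agent -/
  cost : Fin N → ℝ
  cost_pos : ∀ i, 0 < cost i
  /-- `q n` is the probability of success when `n` agents work; only `n ≤ N` matters -/
  q : ℕ → ℝ
  q_mem : ∀ n ≤ N, q n ∈ Icc (0 : ℝ) 1
  q_lt : ∀ n < N, q n < q (n + 1)
  /-- the state of nature lies in the interval `[lo, hi]` -/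
  lo : ℝ
  hi : ℝ
  lo_lt_hi : lo < hi
  /-- the common prior density of the state, with support `[lo, hi]` -/
  g : ℝ → ℝ
  g_cont : ContinuousOn g (Icc lo hi)
  g_pos : ∀ x ∈ Icc lo hi, 0 < g x
  g_int : ∫ x in Icc lo hi, g x = 1
  /-- the density of the i.i.d. noise terms, with support `[-1/2, 1/2]` -/
  f : ℝ → ℝ
  f_nonneg : ∀ t, 0 ≤ f t
  f_cont : ContinuousOn f (Icc (-1 / 2) (1 / 2))
  f_supp : tsupport f = Icc (-1 / 2) (1 / 2)
  f_int : ∫ t, f t = 1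

namespace PrincipalAgent

variable {N : ℕ} (M : PrincipalAgent N)

/-- The common law of the noise terms. -/
def noiseLaw : Measure ℝ :=
  volume.withDensity fun t => ENNReal.ofReal (M.f t)

/-- The set of signals `x + ε η` that an agent can receive (up to the two end points, at which the
posterior is not defined). -/
def signals (ε : ℝ) : Set ℝ :=
  Ioo (M.lo - ε / 2) (M.hi + ε / 2)

/-- The joint density of the state and the signal `s = x + ε η`, as a measure in the state `x`. -/
def stateWeight (ε s : ℝ) : Measure ℝ :=
  (volume.restrict (Icc M.lo M.hi)).withDensity fun x =>
    ENNReal.ofReal (M.g x * (M.f ((s - x) / ε) / ε))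

/-- The posterior law of the state given the own signal `s` (Bayes' rule). -/
def statePosterior (ε s : ℝ) : Measure ℝ :=
  (M.stateWeight ε s univ)⁻¹ • M.stateWeight ε s

/-- The posterior law of the state and of the opponents' signals `x + ε η_j`, `j ≠ i`, given that
agent `i` received the signal `s`. -/
def posterior (ε : ℝ) (i : Fin N) (s : ℝ) : Measure (ℝ × ({j : Fin N // j ≠ i} → ℝ)) :=
  ((M.statePosterior ε s).prod (Measure.pi fun _ : {j : Fin N // j ≠ i} => M.noiseLaw)).map
    fun z => (z.1, fun j => z.1 + ε * z.2 j)

/-- Realized payoff of agent `i` with promised reward `v i`: the reward is paid on success only,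
whatever the agent's action; working (`a = true`) costs `cost i`, shirking yields `-x`. -/
def payoff (v : Fin N → ℝ) (i : Fin N) (a success : Bool) (x : ℝ) : ℝ :=
  (if success then v i else 0) - (if a then M.cost i else x)

/-- Expected payoff of agent `i` over project success, when `n` of the other agents work. -/
def meanPayoff (v : Fin N → ℝ) (i : Fin N) (a : Bool) (n : ℕ) (x : ℝ) : ℝ :=
  M.q (if a then n + 1 else n) * M.payoff v i a true x +
    (1 - M.q (if a then n + 1 else n)) * M.payoff v i a false x

/-- Expected payoff of agent `i` from action `a` at signal `s`, when every opponent `j` independently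
works with probability `p j (signal of j)`. The sum runs over the set `S` of opponents who work. -/
def interimPayoff (ε : ℝ) (v : Fin N → ℝ) (p : Fin N → ℝ → ℝ) (i : Fin N) (a : Bool) (s : ℝ) : ℝ :=
  ∫ z, ∑ S : Finset {j : Fin N // j ≠ i},
    (∏ j : {j : Fin N // j ≠ i}, if j ∈ S then p j (z.2 j) else 1 - p j (z.2 j)) *
      M.meanPayoff v i a S.card z.1 ∂(M.posterior ε i s)

/-- A strategy vector: each agent works with a probability that depends measurably on his signal. -/
def IsStrategyVector (p : Fin N → ℝ → ℝ) : Prop :=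
  ∀ i, Measurable (p i) ∧ ∀ s, p i s ∈ Icc (0 : ℝ) 1

/-- Bayesian Nash equilibrium of the game with noise scale `ε` and rewards `v`: at every signal,
every agent's probability of working is a best response. -/
def IsBNE (ε : ℝ) (v : Fin N → ℝ) (p : Fin N → ℝ → ℝ) : Prop :=
  IsStrategyVector p ∧ ∀ i, ∀ s ∈ M.signals ε, ∀ r ∈ Icc (0 : ℝ) 1,
    r * M.interimPayoff ε v p i true s + (1 - r) * M.interimPayoff ε v p i false s ≤
      p i s * M.interimPayoff ε v p i true s + (1 - p i s) * M.interimPayoff ε v p i false s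

/-- The vector of increasing strategies with common switching point `X`: work iff the signal is at
least `X`. -/
def switching (N : ℕ) (X : ℝ) : Fin N → ℝ → ℝ :=
  fun _ => (Ici X).indicator fun _ => 1

/-- The rewards `v` implement the switching strategies at `X`: these form a Bayesian Nash
equilibrium, and any equilibrium agrees with them at every signal other than `X` itself (at which
agents are indifferent). -/
def Implements (ε : ℝ) (v : Fin N → ℝ) (X : ℝ) : Prop :=
  M.IsBNE ε v (switching N X) ∧
    ∀ p, M.IsBNE ε v p → ∀ i, ∀ s ∈ M.signals ε, s ≠ X → p i s = switching N X i s

/-- The average marginal contribution of an agent to the probability of success. -/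
def qbar : ℝ :=
  ∑ n ∈ Finset.range N, (M.q (n + 1) - M.q n) / N

end PrincipalAgent

end

/-!
Working rather than shirking changes the expected payoff of agent `i` in state `x` by
`x - cost i + v i * H x`, where `H x` is his expected marginal contribution to the success of the
project. The opponents' signals are independent given the state, so `H x` is the mean of the
marginal contribution over a random set of workers in which opponent `j` is included with his
probability of working (`interimPayoff_sub`). An equilibrium is thus a strategy vector that obeys
the sign of the function `gain`, the gain from working weighted by the density of the signal
(`isBNE_iff`). Against any strategies this function is continuous in the signal, although the noise
density may jump at the end points of its support (`continuous_gain`).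

Hence, if switching at `xt` is an equilibrium, then each agent is indifferent at the signal `xt`
(`gain_switching_eq_zero`). This condition is affine in `v i` with positive slope, and its
coefficients depend on the agent only through `cost i`. So rewards are unique and equal costs get
equal rewards (`reward_unique`). As the noise vanishes, the posterior of the own noise term `t`
tends to its prior law. The opponents who work at the switching point are those with a noise term of
at least `t`, and the probability of this event is uniformly distributed. The number of workers
among the opponents is therefore uniform on `0, …, N - 1`, because all Bernstein polynomials of
degree `N - 1` have the same integral over `[0, 1]`. The expected contribution tends to `qbar`
(`integral_rankContribution`, `tendsto_indifferenceReward`).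

For existence, take the rewards that make everybody indifferent at `xt`. If the common switching
point moves to `X`, the beliefs about the rank of the own signal are unchanged, and the posterior of
the own noise term changes by `o(1) * |X - xt|` only, because the logarithm of the prior has a
uniformly continuous derivative. So the gain at the switching point `X` has the sign of `X - xt`
(`gain_switching_self_sign`). Let `p` be any equilibrium, and let `X` be the supremum of the signals
at which some agent does not work for sure. By dominance `X` is not near the upper end of the
range. If `X > xt`, then by strategic complementarities the gain at `X` against `p` is at least the
gain against switching at `X`, so it is positive for all agents. By continuity everybody works near
`X`, which contradicts the choice of `X`. The argument from below is the same
(`implements_of_gain_sign`). The comparison with switching at `X` also shows that switching at `xt`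
is an equilibrium.
-/

noncomputable section

/-! ### Means over random subsets -/

/-- The expectation of `φ S`, where `S` is the random set that contains each `j` independently with
probability `π j`. -/
def bernoulliMean {ι : Type*} [Fintype ι] [DecidableEq ι] (π : ι → ℝ) (φ : Finset ι → ℝ) : ℝ :=
  ∑ S : Finset ι, (∏ j, if j ∈ S then π j else 1 - π j) * φ S

section BernoulliMean

variable {ι : Type*} [DecidableEq ι]

theorem sum_powerset_insert_bernoulli {s : Finset ι} {a : ι} (ha : a ∉ s) (π : ι → ℝ)
    (φ : Finset ι → ℝ) :
    ∑ S ∈ (insert a s).powerset, (∏ j ∈ insert a s, if j ∈ S then π j else 1 - π j) * φ S =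
      π a * ∑ S ∈ s.powerset, (∏ j ∈ s, if j ∈ S then π j else 1 - π j) * φ (insert a S) +
      (1 - π a) * ∑ S ∈ s.powerset, (∏ j ∈ s, if j ∈ S then π j else 1 - π j) * φ S := by
  rw [Finset.sum_powerset_insert ha, add_comm, Finset.mul_sum, Finset.mul_sum]
  congr 1
  · refine Finset.sum_congr rfl fun S _ => ?_
    rw [Finset.prod_insert ha, if_pos (Finset.mem_insert_self a S), mul_assoc]
    congr 2
    refine Finset.prod_congr rfl fun j hj => ?_
    have hja : j ≠ a := fun h => ha (h ▸ hj)
    simp [hja]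
  · refine Finset.sum_congr rfl fun S hS => ?_
    rw [Finset.prod_insert ha, if_neg fun h => ha (Finset.mem_powerset.1 hS h), mul_assoc]

theorem prod_bernoulli_nonneg {π : ι → ℝ} (hπ : ∀ j, π j ∈ Icc (0 : ℝ) 1) (s S : Finset ι) :
    0 ≤ ∏ j ∈ s, if j ∈ S then π j else 1 - π j := by
  refine Finset.prod_nonneg fun j _ => ?_
  split_ifs
  · exact (hπ j).1
  · linarith [(hπ j).2]

/-- Raising the probabilities raises the expectation of a monotone function, one coordinate at a
time. -/
theorem sum_bernoulli_le_sum_bernoulli {π π' : ι → ℝ} (hπ : ∀ j, π j ∈ Icc (0 : ℝ) 1)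
    (hπ' : ∀ j, π' j ∈ Icc (0 : ℝ) 1) (h : ∀ j, π j ≤ π' j) (s : Finset ι) :
    ∀ φ : Finset ι → ℝ, Monotone φ →
      ∑ S ∈ s.powerset, (∏ j ∈ s, if j ∈ S then π j else 1 - π j) * φ S ≤
        ∑ S ∈ s.powerset, (∏ j ∈ s, if j ∈ S then π' j else 1 - π' j) * φ S := by
  induction s using Finset.induction_on with
  | empty => intro φ _; simp
  | insert a s ha ih =>
    intro φ hφ
    rw [sum_powerset_insert_bernoulli ha, sum_powerset_insert_bernoulli ha]
    have h1 := ih (fun S => φ (insert a S)) fun S T hST => hφ (Finset.insert_subset_insert a hST)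
    have h2 := ih φ hφ
    have h3 : ∑ S ∈ s.powerset, (∏ j ∈ s, if j ∈ S then π' j else 1 - π' j) * φ S ≤
        ∑ S ∈ s.powerset, (∏ j ∈ s, if j ∈ S then π' j else 1 - π' j) * φ (insert a S) :=
      Finset.sum_le_sum fun S _ => mul_le_mul_of_nonneg_left
        (hφ (Finset.subset_insert a S)) (prod_bernoulli_nonneg hπ' s S)
    have h4 := mul_le_mul_of_nonneg_left h1 (hπ a).1
    have h5 := mul_le_mul_of_nonneg_left h2 (sub_nonneg.2 (hπ a).2)
    have h6 := mul_le_mul_of_nonneg_left h3 (sub_nonneg.2 (h a))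
    linarith

variable [Fintype ι]

theorem sum_prod_bernoulli (π : ι → ℝ) :
    ∑ S : Finset ι, ∏ j, (if j ∈ S then π j else 1 - π j) = 1 := by
  have h := Finset.prod_add π (fun j => 1 - π j) Finset.univ
  simp only [add_sub_cancel, Finset.prod_const_one, Finset.powerset_univ] at h
  refine Eq.trans (Finset.sum_congr rfl fun S _ => ?_) h.symm
  rw [Finset.prod_ite, Finset.filter_mem_eq_inter, Finset.univ_inter]
  congr 2
  ext j
  simp

theorem bernoulliMean_const (π : ι → ℝ) (c : ℝ) : bernoulliMean π (fun _ => c) = c := by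
  rw [bernoulliMean, ← Finset.sum_mul, sum_prod_bernoulli, one_mul]

theorem bernoulliMean_mono_right {π : ι → ℝ} (hπ : ∀ j, π j ∈ Icc (0 : ℝ) 1)
    {φ ψ : Finset ι → ℝ} (h : ∀ S, φ S ≤ ψ S) : bernoulliMean π φ ≤ bernoulliMean π ψ :=
  Finset.sum_le_sum fun S _ => mul_le_mul_of_nonneg_left (h S) (prod_bernoulli_nonneg hπ _ S)

theorem bernoulliMean_mono_left {π π' : ι → ℝ} (hπ : ∀ j, π j ∈ Icc (0 : ℝ) 1)
    (hπ' : ∀ j, π' j ∈ Icc (0 : ℝ) 1) (h : ∀ j, π j ≤ π' j) {φ : Finset ι → ℝ} (hφ : Monotone φ) :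
    bernoulliMean π φ ≤ bernoulliMean π' φ := by
  simpa [bernoulliMean] using sum_bernoulli_le_sum_bernoulli hπ hπ' h Finset.univ φ hφ

/-- With equal probabilities, the size of the random set is binomially distributed. -/
theorem bernoulliMean_card (u : ℝ) (a : ℕ → ℝ) :
    bernoulliMean (fun _ : ι => u) (fun S => a S.card) =
      ∑ k ∈ Finset.range (Fintype.card ι + 1),
        (bernsteinPolynomial ℝ (Fintype.card ι) k).eval u * a k := by
  have h : ∀ S : Finset ι, (∏ j, if j ∈ S then u else 1 - u) * a S.card =
      (fun k => u ^ k * (1 - u) ^ (Fintype.card ι - k) * a k) S.card := fun S => by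
    simp only
    rw [Finset.prod_ite, Finset.filter_mem_eq_inter, Finset.univ_inter, Finset.prod_const,
      Finset.prod_const, ← Finset.compl_filter, Finset.card_compl]
    simp
  rw [bernoulliMean, Finset.sum_congr rfl fun S _ => h S, ← Finset.powerset_univ,
    Finset.sum_powerset_apply_card (fun k => u ^ k * (1 - u) ^ (Fintype.card ι - k) * a k),
    Finset.card_univ]
  refine Finset.sum_congr rfl fun k _ => ?_
  simp [bernsteinPolynomial, nsmul_eq_mul, mul_assoc]

end BernoulliMean

/-! ### Integrals of Bernstein polynomials -/

/-- Consecutive Bernstein polynomials have the same integral, because their difference is the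
derivative of a polynomial that vanishes at both end points. -/
theorem integral_bernstein_succ {m k : ℕ} (hk : k < m) :
    ∫ u in (0 : ℝ)..1, (bernsteinPolynomial ℝ m (k + 1)).eval u =
      ∫ u in (0 : ℝ)..1, (bernsteinPolynomial ℝ m k).eval u := by
  have h1 : ∫ u in (0 : ℝ)..1,
      (Polynomial.derivative (bernsteinPolynomial ℝ (m + 1) (k + 1))).eval u = 0 := by
    rw [intervalIntegral.integral_eq_sub_of_hasDerivAt
      (fun u _ => (bernsteinPolynomial ℝ (m + 1) (k + 1)).hasDerivAt u)
      ((Polynomial.continuous _).intervalIntegrable _ _),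
      bernsteinPolynomial.eval_at_0, bernsteinPolynomial.eval_at_1]
    simp [hk.ne]
  rw [bernsteinPolynomial.derivative_succ] at h1
  simp only [add_tsub_cancel_right, Polynomial.eval_mul, Polynomial.eval_sub,
    Polynomial.eval_natCast] at h1
  rw [intervalIntegral.integral_const_mul,
    intervalIntegral.integral_sub ((Polynomial.continuous _).intervalIntegrable _ _)
    ((Polynomial.continuous _).intervalIntegrable _ _)] at h1
  have h2 : ((m + 1 : ℕ) : ℝ) ≠ 0 := by positivity
  have := (mul_eq_zero.1 h1).resolve_left h2
  linarith

theorem integral_bernstein {m k : ℕ} (hk : k ≤ m) :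
    ∫ u in (0 : ℝ)..1, (bernsteinPolynomial ℝ m k).eval u = 1 / (m + 1) := by
  have h0 : ∀ k ≤ m, ∫ u in (0 : ℝ)..1, (bernsteinPolynomial ℝ m k).eval u =
      ∫ u in (0 : ℝ)..1, (bernsteinPolynomial ℝ m 0).eval u := fun k => by
    induction k with
    | zero => simp
    | succ k ih => exact fun h => (integral_bernstein_succ h).trans (ih (by omega))
  have h1 : ∑ k ∈ Finset.range (m + 1), ∫ u in (0 : ℝ)..1, (bernsteinPolynomial ℝ m k).eval u
      = 1 := by
    rw [← intervalIntegral.integral_finsetSum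
      fun k _ => (Polynomial.continuous _).intervalIntegrable _ _]
    simp only [← Polynomial.eval_finsetSum, bernsteinPolynomial.sum]
    simp
  rw [Finset.sum_congr rfl fun k hk => h0 k (by simpa [Nat.lt_succ_iff] using hk)] at h1
  rw [h0 k hk]
  have h2 : (m : ℝ) + 1 ≠ 0 := by positivity
  simp only [Finset.sum_const, Finset.card_range, nsmul_eq_mul] at h1
  push_cast at h1
  field_simp
  linarith

/-- Under a uniform probability of working, the number of workers is uniformly distributed. -/
theorem integral_sum_bernstein (m : ℕ) (a : ℕ → ℝ) :
    ∫ u in (0 : ℝ)..1, ∑ k ∈ Finset.range (m + 1), (bernsteinPolynomial ℝ m k).eval u * a k =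
      ∑ k ∈ Finset.range (m + 1), a k / (m + 1) := by
  rw [intervalIntegral.integral_finsetSum fun k _ =>
    (((Polynomial.continuous _).intervalIntegrable _ _).mul_const _)]
  refine Finset.sum_congr rfl fun k hk => ?_
  rw [intervalIntegral.integral_mul_const,
    integral_bernstein (by simpa [Nat.lt_succ_iff] using hk)]
  ring

namespace PrincipalAgent

variable {N : ℕ} (M : PrincipalAgent N)

/-! ### The prior -/

/-- The prior density, extended from `[lo, hi]` to a continuous positive function on `ℝ` that is
constant on either side of the interval. -/
def prior : ℝ → ℝ :=
  IccExtend M.lo_lt_hi.le ((Icc M.lo M.hi).domRestrict M.g)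

theorem continuous_prior : Continuous M.prior :=
  (continuousOn_iff_continuous_domRestrict.1 M.g_cont).Icc_extend'

theorem prior_pos (x : ℝ) : 0 < M.prior x :=
  M.g_pos _ (projIcc M.lo M.hi M.lo_lt_hi.le x).2

theorem prior_eq {x : ℝ} (hx : x ∈ Icc M.lo M.hi) : M.prior x = M.g x := by
  rw [prior, IccExtend_of_mem _ _ hx, domRestrict_apply]

theorem exists_prior_le : ∃ C, ∀ x, M.prior x ≤ C := by
  obtain ⟨C, hC⟩ := isCompact_Icc.bddAbove_image M.g_cont
  exact ⟨C, fun x => hC (mem_image_of_mem _ (projIcc M.lo M.hi M.lo_lt_hi.le x).2)⟩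

/-! ### The law of the noise -/

theorem f_eq_zero {t : ℝ} (ht : t ∉ Icc (-1 / 2 : ℝ) (1 / 2)) : M.f t = 0 :=
  image_eq_zero_of_notMem_tsupport (by rwa [M.f_supp])

theorem measurable_f : Measurable M.f := by
  have h : M.f = (Icc (-1 / 2 : ℝ) (1 / 2)).piecewise M.f (fun _ => 0) := by
    ext t
    by_cases ht : t ∈ Icc (-1 / 2 : ℝ) (1 / 2)
    · rw [piecewise_eq_of_mem _ _ _ ht]
    · rw [piecewise_eq_of_notMem _ _ _ ht, M.f_eq_zero ht]
  rw [h]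
  exact M.f_cont.measurable_piecewise continuousOn_const measurableSet_Icc

theorem exists_f_le : ∃ C, ∀ t, M.f t ≤ C := by
  obtain ⟨C, hC⟩ := isCompact_Icc.bddAbove_image M.f_cont
  refine ⟨max C 0, fun t => ?_⟩
  by_cases ht : t ∈ Icc (-1 / 2 : ℝ) (1 / 2)
  · exact (hC (mem_image_of_mem _ ht)).trans (le_max_left _ _)
  · rw [M.f_eq_zero ht]
    exact le_max_right _ _

theorem integrable_f : Integrable M.f := by
  by_contra h
  have := M.f_int
  rw [integral_undef h] at this
  exact zero_ne_one this

theorem continuousAt_f {t : ℝ} (h1 : t ≠ -1 / 2) (h2 : t ≠ 1 / 2) : ContinuousAt M.f t := by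
  by_cases ht : t ∈ Icc (-1 / 2 : ℝ) (1 / 2)
  · exact M.f_cont.continuousAt (Icc_mem_nhds (lt_of_le_of_ne ht.1 h1.symm)
      (lt_of_le_of_ne ht.2 h2))
  · refine (continuousAt_const (y := (0 : ℝ))).congr ?_
    filter_upwards [isClosed_Icc.isOpen_compl.mem_nhds ht] with u hu
    exact (M.f_eq_zero hu).symm

instance isProbabilityMeasure_noiseLaw : IsProbabilityMeasure M.noiseLaw := by
  constructor
  rw [noiseLaw, withDensity_apply _ MeasurableSet.univ, Measure.restrict_univ,
    ← ofReal_integral_eq_lintegral_ofReal M.integrable_f (ae_of_all _ M.f_nonneg), M.f_int,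
    ENNReal.ofReal_one]

theorem noiseLaw_absolutelyContinuous : M.noiseLaw ≪ volume :=
  withDensity_absolutelyContinuous _ _

instance nullSingletonClass_noiseLaw : NullSingletonClass M.noiseLaw :=
  ⟨fun _ => M.noiseLaw_absolutelyContinuous (measure_singleton _)⟩

theorem integral_noiseLaw (h : ℝ → ℝ) : ∫ t, h t ∂M.noiseLaw = ∫ t, M.f t * h t := by
  rw [noiseLaw, integral_withDensity_eq_integral_toReal_smul M.measurable_f.ennreal_ofReal
    (ae_of_all _ fun _ => ENNReal.ofReal_lt_top)]
  refine integral_congr_ae (ae_of_all _ fun t => ?_)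
  simp [ENNReal.toReal_ofReal (M.f_nonneg t)]

theorem ae_noiseLaw_mem_Icc : ∀ᵐ t ∂M.noiseLaw, t ∈ Icc (-1 / 2 : ℝ) (1 / 2) := by
  rw [noiseLaw, ae_withDensity_iff M.measurable_f.ennreal_ofReal]
  refine ae_of_all _ fun t ht => ?_
  by_contra h
  simp [M.f_eq_zero h] at ht

theorem ae_noiseLaw_mem_Ioo : ∀ᵐ t ∂M.noiseLaw, t ∈ Ioo (-1 / 2 : ℝ) (1 / 2) := by
  have h1 : ∀ a : ℝ, ∀ᵐ t ∂M.noiseLaw, t ≠ a := fun a => by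
    rw [ae_iff]
    simp
  filter_upwards [M.ae_noiseLaw_mem_Icc, h1 (-1 / 2), h1 (1 / 2)] with t h h2 h3
  exact ⟨lt_of_le_of_ne h.1 h2.symm, lt_of_le_of_ne h.2 h3⟩

/-! ### The posterior of the state -/

/-- The joint density of the state `x` and the signal `s`. -/
def weight (ε s x : ℝ) : ℝ :=
  M.prior x * (M.f ((s - x) / ε) / ε)

/-- The density of the signal at `s`. -/
def signalDensity (ε s : ℝ) : ℝ :=
  ∫ x in Icc M.lo M.hi, M.weight ε s x

theorem measurable_weight (ε s : ℝ) : Measurable (M.weight ε s) := by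
  have := M.measurable_f
  have := M.continuous_prior.measurable
  unfold weight
  fun_prop

theorem weight_nonneg {ε : ℝ} (hε : 0 < ε) (s x : ℝ) : 0 ≤ M.weight ε s x :=
  mul_nonneg (M.prior_pos x).le (div_nonneg (M.f_nonneg _) hε.le)

theorem exists_weight_le {ε : ℝ} (hε : 0 < ε) : ∃ C, ∀ s x, M.weight ε s x ≤ C := by
  obtain ⟨C, hC⟩ := M.exists_prior_le
  obtain ⟨D, hD⟩ := M.exists_f_le
  refine ⟨C * (D / ε), fun s x => ?_⟩
  exact mul_le_mul (hC x) (div_le_div_of_nonneg_right (hD _) hε.le)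
    (div_nonneg (M.f_nonneg _) hε.le) ((M.prior_pos x).le.trans (hC x))

theorem weight_eq_zero {ε s x : ℝ} (hε : 0 < ε) (h : x ∉ Icc (s - ε / 2) (s + ε / 2)) :
    M.weight ε s x = 0 := by
  rw [weight, M.f_eq_zero, zero_div, mul_zero]
  intro h'
  apply h
  rw [mem_Icc, div_le_iff₀ hε, le_div_iff₀ hε] at h'
  constructor <;> linarith [h'.1, h'.2]

theorem integrable_weight_mul {ε : ℝ} (hε : 0 < ε) (s : ℝ) {h : ℝ → ℝ} (hm : Measurable h) {C : ℝ}
    (hC : ∀ x ∈ Icc M.lo M.hi, |h x| ≤ C) :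
    IntegrableOn (fun x => M.weight ε s x * h x) (Icc M.lo M.hi) := by
  obtain ⟨D, hD⟩ := M.exists_weight_le hε
  refine Measure.integrableOn_of_bounded (M := D * C) (by simp)
    ((M.measurable_weight ε s).mul hm).aestronglyMeasurable ?_
  filter_upwards [ae_restrict_mem measurableSet_Icc] with x hx
  rw [norm_mul, Real.norm_eq_abs, Real.norm_eq_abs, abs_of_nonneg (M.weight_nonneg hε s x)]
  exact mul_le_mul (hD s x) (hC x hx) (abs_nonneg _) ((M.weight_nonneg hε s x).trans (hD s x))

theorem integrable_weight {ε : ℝ} (hε : 0 < ε) (s : ℝ) :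
    IntegrableOn (M.weight ε s) (Icc M.lo M.hi) := by
  simpa using M.integrable_weight_mul hε s (h := fun _ => 1) measurable_const (C := 1) (by simp)

/-- Every signal in the open range has positive density, because the noise density does not vanish
on any open subset of its support. -/
theorem signalDensity_pos {ε s : ℝ} (hε : 0 < ε) (hs : s ∈ M.signals ε) :
    0 < M.signalDensity ε s := by
  obtain ⟨x₀, hx₀, hx₀'⟩ : ∃ x, x ∈ Ioo M.lo M.hi ∧ x ∈ Ioo (s - ε / 2) (s + ε / 2) := by
    have h1 := hs.1
    have h2 := hs.2
    have h3 := M.lo_lt_hi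
    obtain ⟨x, hx1, hx2⟩ := exists_between
      (show max M.lo (s - ε / 2) < min M.hi (s + ε / 2) by
        rw [max_lt_iff, lt_min_iff, lt_min_iff]
        refine ⟨⟨h3, by linarith⟩, by linarith, by linarith⟩)
    rw [max_lt_iff] at hx1
    rw [lt_min_iff] at hx2
    exact ⟨x, ⟨hx1.1, hx2.1⟩, hx1.2, hx2.2⟩
  have hO : IsOpen {t : ℝ | t ∈ Ioo (-1 / 2 : ℝ) (1 / 2) ∧ s - ε * t ∈ Ioo M.lo M.hi} :=
    isOpen_Ioo.inter (isOpen_Ioo.preimage (by fun_prop))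
  have ht₀ : (s - x₀) / ε ∈ Ioo (-1 / 2 : ℝ) (1 / 2) := by
    rw [mem_Ioo, lt_div_iff₀ hε, div_lt_iff₀ hε]
    constructor <;> linarith [hx₀'.1, hx₀'.2]
  have hcl : (s - x₀) / ε ∈ closure (Function.support M.f) := by
    change _ ∈ tsupport M.f
    rw [M.f_supp]
    exact Ioo_subset_Icc_self ht₀
  obtain ⟨t, ⟨ht1, ht2⟩, ht3⟩ := mem_closure_iff.1 hcl _ hO
    ⟨ht₀, by rwa [mul_div_cancel₀ _ hε.ne', sub_sub_cancel]⟩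
  have hfc : ContinuousAt (fun x => M.f ((s - x) / ε)) (s - ε * t) := by
    refine ContinuousAt.comp' (f := fun x : ℝ => (s - x) / ε) ?_ (by fun_prop)
    rw [sub_sub_cancel, mul_div_cancel_left₀ _ hε.ne']
    exact M.continuousAt_f ht1.1.ne' ht1.2.ne
  rw [signalDensity, setIntegral_pos_iff_support_of_nonneg_ae
    (ae_of_all _ (M.weight_nonneg hε s)) (M.integrable_weight hε s)]
  refine Measure.measure_pos_of_mem_nhds volume (x := s - ε * t) ?_
  filter_upwards [Icc_mem_nhds ht2.1 ht2.2, hfc.eventually_ne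
    (show M.f ((s - (s - ε * t)) / ε) ≠ 0 by
      rw [sub_sub_cancel, mul_div_cancel_left₀ _ hε.ne']; exact ht3)] with x hx1 hx2
  exact ⟨mul_ne_zero (M.prior_pos x).ne' (div_ne_zero hx2 hε.ne'), hx1⟩

theorem stateWeight_eq (ε s : ℝ) : M.stateWeight ε s =
    (volume.restrict (Icc M.lo M.hi)).withDensity fun x => ENNReal.ofReal (M.weight ε s x) := by
  refine withDensity_congr_ae ?_
  filter_upwards [ae_restrict_mem measurableSet_Icc] with x hx
  rw [weight, M.prior_eq hx]

theorem stateWeight_univ {ε : ℝ} (hε : 0 < ε) (s : ℝ) :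
    M.stateWeight ε s univ = ENNReal.ofReal (M.signalDensity ε s) := by
  rw [stateWeight_eq, withDensity_apply _ MeasurableSet.univ, Measure.restrict_univ, signalDensity,
    ofReal_integral_eq_lintegral_ofReal (M.integrable_weight hε s)
      (ae_of_all _ (M.weight_nonneg hε s))]

theorem isProbabilityMeasure_statePosterior {ε s : ℝ} (hε : 0 < ε) (hs : s ∈ M.signals ε) :
    IsProbabilityMeasure (M.statePosterior ε s) := by
  constructor
  rw [statePosterior, Measure.smul_apply, smul_eq_mul, M.stateWeight_univ hε]
  exact ENNReal.inv_mul_cancel (by simpa using M.signalDensity_pos hε hs) ENNReal.ofReal_ne_top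

theorem integral_statePosterior {ε s : ℝ} (hε : 0 < ε) (hs : s ∈ M.signals ε) (h : ℝ → ℝ) :
    ∫ x, h x ∂M.statePosterior ε s =
      (M.signalDensity ε s)⁻¹ * ∫ x in Icc M.lo M.hi, M.weight ε s x * h x := by
  rw [statePosterior, integral_smul_measure, M.stateWeight_univ hε, stateWeight_eq,
    integral_withDensity_eq_integral_toReal_smul (M.measurable_weight ε s).ennreal_ofReal
    (ae_of_all _ fun _ => ENNReal.ofReal_lt_top), ENNReal.toReal_inv,
    ENNReal.toReal_ofReal (M.signalDensity_pos hε hs).le, smul_eq_mul]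
  congr 1
  refine integral_congr_ae (ae_of_all _ fun x => ?_)
  simp [ENNReal.toReal_ofReal (M.weight_nonneg hε s x)]

theorem ae_statePosterior_mem (ε s : ℝ) : ∀ᵐ x ∂M.statePosterior ε s, x ∈ Icc M.lo M.hi :=
  ((Measure.smul_absolutelyContinuous (c := (M.stateWeight ε s univ)⁻¹)).trans
    (withDensity_absolutelyContinuous _ _)).ae_le (ae_restrict_mem measurableSet_Icc)

/-! ### The gain from working -/

/-- The probability that an agent with strategy `p` works when the state is `x`. -/
def workProb (ε : ℝ) (p : ℝ → ℝ) (x : ℝ) : ℝ :=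
  ∫ t, p (x + ε * t) ∂M.noiseLaw

/-- The increase in the probability of success due to one more worker when `n` agents work. -/
def marginal (n : ℕ) : ℝ :=
  M.q (n + 1) - M.q n

/-- The expected marginal contribution of agent `i` to the probability of success in state `x`. -/
def contribution (ε : ℝ) (p : Fin N → ℝ → ℝ) (i : Fin N) (x : ℝ) : ℝ :=
  bernoulliMean (fun j : {j : Fin N // j ≠ i} => M.workProb ε (p j) x) fun S => M.marginal S.card

/-- The gain of agent `i` from working rather than shirking at signal `s`, times the density of the
signal. -/
def gain (ε : ℝ) (v : Fin N → ℝ) (p : Fin N → ℝ → ℝ) (i : Fin N) (s : ℝ) : ℝ :=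
  ∫ x in Icc M.lo M.hi, M.weight ε s x * (x - M.cost i + v i * M.contribution ε p i x)

theorem marginal_pos {n : ℕ} (hn : n < N) : 0 < M.marginal n :=
  sub_pos.2 (M.q_lt n hn)

theorem marginal_le_one {n : ℕ} (hn : n < N) : M.marginal n ≤ 1 := by
  have h1 := (M.q_mem (n + 1) hn).2
  have h2 := (M.q_mem n hn.le).1
  rw [marginal]
  linarith

theorem card_opponents (i : Fin N) : Fintype.card {j : Fin N // j ≠ i} = N - 1 := by
  simp [Fintype.card_subtype_compl]

theorem card_lt {i : Fin N} (S : Finset {j : Fin N // j ≠ i}) : S.card < N := by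
  have h1 := S.card_le_univ
  rw [card_opponents] at h1
  have := i.pos
  omega

theorem exists_le_marginal : ∃ d > 0, ∀ n < N, d ≤ M.marginal n := by
  rcases Nat.eq_zero_or_pos N with rfl | hN
  · exact ⟨1, one_pos, fun n hn => absurd hn (Nat.not_lt_zero n)⟩
  · obtain ⟨n, hn, h⟩ := Finset.exists_min_image (Finset.range N) M.marginal ⟨0, by simpa⟩
    exact ⟨M.marginal n, M.marginal_pos (by simpa using hn), fun k hk => h k (by simpa using hk)⟩

variable {M} in
theorem IsStrategyVector.integrable {p : Fin N → ℝ → ℝ} (hp : IsStrategyVector p) (j : Fin N)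
    (ε x : ℝ) : Integrable (fun t => p j (x + ε * t)) M.noiseLaw := by
  refine Integrable.of_bound (C := 1)
    ((hp j).1.comp (by fun_prop : Measurable fun t : ℝ => x + ε * t)).aestronglyMeasurable
    (ae_of_all _ fun t => ?_)
  rw [Real.norm_eq_abs, abs_of_nonneg ((hp j).2 _).1]
  exact ((hp j).2 _).2

theorem workProb_mem {p : Fin N → ℝ → ℝ} (hp : IsStrategyVector p) (j : Fin N) (ε x : ℝ) :
    M.workProb ε (p j) x ∈ Icc (0 : ℝ) 1 := by
  constructor
  · exact integral_nonneg fun t => ((hp j).2 _).1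
  · have := integral_mono (μ := M.noiseLaw) (hp.integrable j ε x) (integrable_const 1)
      fun t => ((hp j).2 _).2
    simpa [workProb] using this

theorem measurable_workProb {p : Fin N → ℝ → ℝ} (hp : IsStrategyVector p) (j : Fin N) (ε : ℝ) :
    Measurable (M.workProb ε (p j)) := by
  have h : StronglyMeasurable fun z : ℝ × ℝ => p j (z.1 + ε * z.2) :=
    ((hp j).1.comp (by fun_prop)).stronglyMeasurable
  exact (h.integral_prod_right (ν := M.noiseLaw)).measurable

theorem measurable_contribution {p : Fin N → ℝ → ℝ} (hp : IsStrategyVector p) (i : Fin N) (ε : ℝ) :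
    Measurable (M.contribution ε p i) := by
  have h := fun j => M.measurable_workProb hp j ε
  unfold contribution bernoulliMean
  refine Finset.measurable_sum _ fun S _ => Measurable.mul_const ?_ _
  refine Finset.measurable_prod _ fun j _ => ?_
  split_ifs
  · exact h j
  · exact measurable_const.sub (h j)

theorem le_contribution {p : Fin N → ℝ → ℝ} (hp : IsStrategyVector p) (i : Fin N) (ε x : ℝ) {d : ℝ}
    (hd : ∀ n < N, d ≤ M.marginal n) : d ≤ M.contribution ε p i x := by
  rw [← bernoulliMean_const (fun j : {j : Fin N // j ≠ i} => M.workProb ε (p j) x) d]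
  refine bernoulliMean_mono_right (fun j => ?_) fun S => ?_
  · exact M.workProb_mem hp j ε x
  · exact hd _ (card_lt S)

theorem contribution_le {p : Fin N → ℝ → ℝ} (hp : IsStrategyVector p) (i : Fin N) (ε x : ℝ) {d : ℝ}
    (hd : ∀ n < N, M.marginal n ≤ d) : M.contribution ε p i x ≤ d := by
  rw [← bernoulliMean_const (fun j : {j : Fin N // j ≠ i} => M.workProb ε (p j) x) d]
  refine bernoulliMean_mono_right (fun j => ?_) fun S => ?_
  · exact M.workProb_mem hp j ε x
  · exact hd _ (card_lt S)

theorem contribution_mem {p : Fin N → ℝ → ℝ} (hp : IsStrategyVector p) (i : Fin N) (ε x : ℝ) :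
    M.contribution ε p i x ∈ Icc (0 : ℝ) 1 :=
  ⟨M.le_contribution hp i ε x fun _ hn => (M.marginal_pos hn).le,
    M.contribution_le hp i ε x fun _ hn => M.marginal_le_one hn⟩

theorem meanPayoff_true (v : Fin N → ℝ) (i : Fin N) (n : ℕ) (x : ℝ) :
    M.meanPayoff v i true n x = M.q (n + 1) * v i - M.cost i := by
  simp [meanPayoff, payoff]
  ring

theorem meanPayoff_false (v : Fin N → ℝ) (i : Fin N) (n : ℕ) (x : ℝ) :
    M.meanPayoff v i false n x = M.q n * v i - x := by
  simp [meanPayoff, payoff]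
  ring

/-- Integrating out the independent signals of the opponents replaces their strategies by their
probabilities of working. -/
theorem integral_pi_eq_bernoulliMean {p : Fin N → ℝ → ℝ} (hp : IsStrategyVector p) (i : Fin N)
    (ε x : ℝ) (φ : Finset {j : Fin N // j ≠ i} → ℝ) :
    ∫ y : {j : Fin N // j ≠ i} → ℝ, ∑ S : Finset {j : Fin N // j ≠ i},
      (∏ j : {j : Fin N // j ≠ i}, if j ∈ S then p j (x + ε * y j) else 1 - p j (x + ε * y j)) *
        φ S ∂(Measure.pi fun _ : {j : Fin N // j ≠ i} => M.noiseLaw) =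
      bernoulliMean (fun j : {j : Fin N // j ≠ i} => M.workProb ε (p j) x) φ := by
  have hint : ∀ (S : Finset {j : Fin N // j ≠ i}) (j : {j : Fin N // j ≠ i}),
      Integrable (fun t => if j ∈ S then p j (x + ε * t) else 1 - p j (x + ε * t)) M.noiseLaw := by
    intro S j
    split_ifs
    · exact hp.integrable j ε x
    · exact (integrable_const 1).sub (hp.integrable j ε x)
  rw [integral_finsetSum, bernoulliMean]
  · refine Finset.sum_congr rfl fun S _ => ?_
    rw [integral_mul_const, integral_fintype_prod_eq_prod
      (fun (j : {j : Fin N // j ≠ i}) t =>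
        if j ∈ S then p j (x + ε * t) else 1 - p j (x + ε * t))]
    congr 1
    refine Finset.prod_congr rfl fun j _ => ?_
    split_ifs
    · rfl
    · rw [integral_sub (integrable_const 1) (hp.integrable j ε x)]
      simp [workProb]
  · intro S _
    exact (Integrable.fintype_prod (fun j => hint S j)).mul_const _

theorem integrable_meanPayoff {ε s : ℝ} (hε : 0 < ε) (hs : s ∈ M.signals ε) (v : Fin N → ℝ)
    (i : Fin N) (a : Bool) (n : ℕ) :
    Integrable (M.meanPayoff v i a n) (M.statePosterior ε s) := by
  have := M.isProbabilityMeasure_statePosterior hε hs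
  have hid : Integrable (fun x : ℝ => x) (M.statePosterior ε s) := by
    refine Integrable.of_bound (C := max |M.lo| |M.hi|) (by fun_prop) ?_
    filter_upwards [M.ae_statePosterior_mem ε s] with x hx
    exact abs_le_max_abs_abs hx.1 hx.2
  cases a
  · rw [funext (M.meanPayoff_false v i n)]
    exact (integrable_const _).sub hid
  · rw [funext (M.meanPayoff_true v i n)]
    exact integrable_const _

theorem integrable_interim {p : Fin N → ℝ → ℝ} (hp : IsStrategyVector p) {ε s : ℝ} (hε : 0 < ε)
    (hs : s ∈ M.signals ε) (v : Fin N → ℝ) (i : Fin N) (a : Bool) :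
    Integrable (fun z : ℝ × ({j : Fin N // j ≠ i} → ℝ) => ∑ S : Finset {j : Fin N // j ≠ i},
      (∏ j : {j : Fin N // j ≠ i},
        if j ∈ S then p j (z.1 + ε * z.2 j) else 1 - p j (z.1 + ε * z.2 j)) *
        M.meanPayoff v i a S.card z.1)
      ((M.statePosterior ε s).prod (Measure.pi fun _ : {j : Fin N // j ≠ i} => M.noiseLaw)) := by
  have := M.isProbabilityMeasure_statePosterior hε hs
  have hm : ∀ j : {j : Fin N // j ≠ i}, Measurable
      fun z : ℝ × ({j : Fin N // j ≠ i} → ℝ) => p j (z.1 + ε * z.2 j) :=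
    fun j => (hp j).1.comp (by fun_prop)
  refine integrable_finsetSum _ fun S _ => Integrable.bdd_mul (c := 1)
    ((M.integrable_meanPayoff hε hs v i a _).comp_fst _) ?_ (ae_of_all _ fun z => ?_)
  · refine (Finset.measurable_prod _ fun j _ => ?_).aestronglyMeasurable
    split_ifs
    · exact hm j
    · exact measurable_const.sub (hm j)
  · rw [Real.norm_eq_abs, Finset.abs_prod]
    refine Finset.prod_le_one (fun j _ => abs_nonneg _) fun j _ => ?_
    have h := (hp j).2 (z.1 + ε * z.2 j)
    rw [abs_le]
    split_ifs <;> constructor <;> linarith [h.1, h.2]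

theorem interimPayoff_eq_integral_prod {p : Fin N → ℝ → ℝ} (hp : IsStrategyVector p) (ε s : ℝ)
    (v : Fin N → ℝ) (i : Fin N) (a : Bool) :
    M.interimPayoff ε v p i a s = ∫ z, ∑ S : Finset {j : Fin N // j ≠ i},
      (∏ j : {j : Fin N // j ≠ i},
        if j ∈ S then p j (z.1 + ε * z.2 j) else 1 - p j (z.1 + ε * z.2 j)) *
        M.meanPayoff v i a S.card z.1
      ∂((M.statePosterior ε s).prod (Measure.pi fun _ : {j : Fin N // j ≠ i} => M.noiseLaw)) := by
  rw [interimPayoff, posterior, integral_map]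
  · exact Measurable.aemeasurable (by fun_prop)
  · refine (Finset.measurable_sum _ fun S _ => Measurable.mul ?_ ?_).aestronglyMeasurable
    · refine Finset.measurable_prod _ fun j _ => ?_
      have hm : Measurable fun z : ℝ × ({j : Fin N // j ≠ i} → ℝ) => p j (z.2 j) :=
        (hp j).1.comp (by fun_prop)
      split_ifs
      · exact hm
      · exact measurable_const.sub hm
    · cases a
      · simp only [meanPayoff_false]
        fun_prop
      · simp only [meanPayoff_true]
        fun_prop

/-- The interim gain from working is the function `gain`, up to the density of the signal. -/
theorem interimPayoff_sub {p : Fin N → ℝ → ℝ} (hp : IsStrategyVector p) {ε s : ℝ}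
    (hε : 0 < ε) (hs : s ∈ M.signals ε) (v : Fin N → ℝ) (i : Fin N) :
    M.interimPayoff ε v p i true s - M.interimPayoff ε v p i false s =
      (M.signalDensity ε s)⁻¹ * M.gain ε v p i s := by
  have := M.isProbabilityMeasure_statePosterior hε hs
  have h1 := M.integrable_interim hp hε hs v i true
  have h2 := M.integrable_interim hp hε hs v i false
  rw [M.interimPayoff_eq_integral_prod hp, M.interimPayoff_eq_integral_prod hp,
    ← integral_sub h1 h2]
  refine (integral_prod _ (h1.sub h2)).trans ?_
  rw [gain, ← M.integral_statePosterior hε hs]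
  refine integral_congr_ae (ae_of_all _ fun x => ?_)
  simp only [Pi.sub_apply, ← Finset.sum_sub_distrib, ← mul_sub]
  rw [M.integral_pi_eq_bernoulliMean hp i ε x fun S =>
    M.meanPayoff v i true S.card x - M.meanPayoff v i false S.card x]
  simp only [meanPayoff_true, meanPayoff_false, contribution]
  rw [← bernoulliMean_const (fun j : {j : Fin N // j ≠ i} => M.workProb ε (p j) x) (x - M.cost i)]
  simp only [bernoulliMean, Finset.mul_sum, ← Finset.sum_add_distrib, marginal]
  refine Finset.sum_congr rfl fun S _ => ?_
  ring

/-- Best responses are determined by the sign of the gain from working. -/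
theorem isBNE_iff {ε : ℝ} (hε : 0 < ε) (v : Fin N → ℝ) (p : Fin N → ℝ → ℝ) :
    M.IsBNE ε v p ↔ IsStrategyVector p ∧ ∀ i, ∀ s ∈ M.signals ε,
      (0 < M.gain ε v p i s → p i s = 1) ∧ (M.gain ε v p i s < 0 → p i s = 0) := by
  refine and_congr_right fun hp => forall_congr' fun i => forall₂_congr fun s hs => ?_
  have hZ := inv_pos.2 (M.signalDensity_pos hε hs)
  have hsub := M.interimPayoff_sub hp hε hs v i
  have hps := (hp i).2 s
  set G := M.gain ε v p i s
  set U := M.interimPayoff ε v p i true s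
  set U' := M.interimPayoff ε v p i false s
  have hkey : ∀ r : ℝ, r * U + (1 - r) * U' ≤ p i s * U + (1 - p i s) * U' ↔
      0 ≤ (p i s - r) * G := fun r => by
    rw [← mul_nonneg_iff_of_pos_left hZ, ← sub_nonneg, mul_left_comm, ← hsub]
    ring_nf
  simp only [hkey]
  constructor
  · intro h
    constructor
    · intro hG
      have := h 1 (by simp)
      have := nonneg_of_mul_nonneg_left this hG
      linarith [hps.2]
    · intro hG
      have := h 0 (by simp)
      have := nonpos_of_mul_nonneg_left this hG
      linarith [hps.1]
  · rintro ⟨h1, h2⟩ r hr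
    rcases lt_trichotomy G 0 with hG | hG | hG
    · rw [h2 hG]
      exact mul_nonneg_of_nonpos_of_nonpos (by linarith [hr.1]) hG.le
    · rw [hG, mul_zero]
    · rw [h1 hG]
      exact mul_nonneg (by linarith [hr.2]) hG.le

/-! ### Switching strategies -/

theorem isStrategyVector_switching (X : ℝ) : IsStrategyVector (switching N X) := by
  refine fun i => ⟨measurable_const.indicator measurableSet_Ici, fun s => ?_⟩
  by_cases h : X ≤ s <;> simp [switching, indicator, h]

theorem switching_of_le {X s : ℝ} (h : X ≤ s) (i : Fin N) : switching N X i s = 1 :=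
  indicator_of_mem (mem_Ici.2 h) _

theorem switching_of_lt {X s : ℝ} (h : s < X) (i : Fin N) : switching N X i s = 0 :=
  indicator_of_notMem (notMem_Ici.2 h) _

/-! ### Continuity and monotonicity of the gain -/

theorem exists_abs_payoffGain_le {p : Fin N → ℝ → ℝ} (hp : IsStrategyVector p) (ε : ℝ)
    (v : Fin N → ℝ) (i : Fin N) : ∃ C, ∀ x ∈ Icc M.lo M.hi,
      |x - M.cost i + v i * M.contribution ε p i x| ≤ C := by
  refine ⟨max |M.lo| |M.hi| + |M.cost i| + |v i|, fun x hx => ?_⟩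
  have h1 := M.contribution_mem hp i ε x
  have h2 : |v i * M.contribution ε p i x| ≤ |v i| := by
    rw [abs_mul, abs_of_nonneg h1.1]
    exact mul_le_of_le_one_right (abs_nonneg _) h1.2
  exact (abs_add_le _ _).trans (add_le_add ((abs_sub _ _).trans
    (add_le_add_left (abs_le_max_abs_abs hx.1 hx.2) _)) h2)

theorem integrable_gain {p : Fin N → ℝ → ℝ} (hp : IsStrategyVector p) {ε : ℝ} (hε : 0 < ε)
    (v : Fin N → ℝ) (i : Fin N) (s : ℝ) :
    IntegrableOn (fun x => M.weight ε s x * (x - M.cost i + v i * M.contribution ε p i x))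
      (Icc M.lo M.hi) := by
  obtain ⟨C, hC⟩ := M.exists_abs_payoffGain_le hp ε v i
  have := M.measurable_contribution hp i ε
  exact M.integrable_weight_mul hε s (by fun_prop) hC

/-- The gain is continuous in the signal against any strategies: the noise density jumps at most at
two points, and these affect only a null set of states. -/
theorem continuous_gain {p : Fin N → ℝ → ℝ} (hp : IsStrategyVector p) {ε : ℝ} (hε : 0 < ε)
    (v : Fin N → ℝ) (i : Fin N) : Continuous (M.gain ε v p i) := by
  obtain ⟨C, hC⟩ := M.exists_abs_payoffGain_le hp ε v i
  obtain ⟨D, hD⟩ := M.exists_weight_le hε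
  refine continuous_iff_continuousAt.2 fun s => ?_
  refine continuousAt_of_dominated (bound := fun _ => D * C)
    (Eventually.of_forall fun s' => (M.integrable_gain hp hε v i s').1)
    (Eventually.of_forall fun s' => ?_) (integrable_const _) ?_
  · filter_upwards [ae_restrict_mem measurableSet_Icc] with x hx
    rw [norm_mul, Real.norm_eq_abs, Real.norm_eq_abs, abs_of_nonneg (M.weight_nonneg hε s' x)]
    exact mul_le_mul (hD s' x) (hC x hx) (abs_nonneg _)
      ((M.weight_nonneg hε s' x).trans (hD s' x))
  · have hne : ∀ a : ℝ, ∀ᵐ x ∂volume.restrict (Icc M.lo M.hi), x ≠ a := fun a => by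
      rw [ae_iff]
      simp
    filter_upwards [hne (s + ε / 2), hne (s - ε / 2)] with x hx1 hx2
    refine ContinuousAt.mul ?_ continuousAt_const
    refine continuousAt_const.mul (ContinuousAt.div_const ?_ _)
    refine ContinuousAt.comp' (f := fun s : ℝ => (s - x) / ε) (M.continuousAt_f ?_ ?_)
      (by fun_prop)
    · intro h
      rw [div_eq_iff hε.ne'] at h
      exact hx1 (by linarith)
    · intro h
      rw [div_eq_iff hε.ne'] at h
      exact hx2 (by linarith)

theorem workProb_mono {p p' : Fin N → ℝ → ℝ} (hp : IsStrategyVector p) (hp' : IsStrategyVector p')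
    {ε : ℝ} (hε : 0 < ε) {X : ℝ} {j : Fin N} (h : ∀ s ∈ M.signals ε, s ≠ X → p j s ≤ p' j s)
    {x : ℝ} (hx : x ∈ Icc M.lo M.hi) : M.workProb ε (p j) x ≤ M.workProb ε (p' j) x := by
  refine integral_mono_ae (hp.integrable j ε x) (hp'.integrable j ε x) ?_
  have hne : ∀ᵐ t ∂M.noiseLaw, t ≠ (X - x) / ε := by
    rw [ae_iff]
    simp
  filter_upwards [M.ae_noiseLaw_mem_Ioo, hne] with t ht ht'
  refine h _ ⟨?_, ?_⟩ fun hX => ht' ?_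
  · nlinarith [hx.1, ht.1]
  · nlinarith [hx.2, ht.2]
  · rw [eq_div_iff hε.ne']
    linarith

theorem marginal_mono
    (hq : ∀ n, n + 2 ≤ N → M.q (n + 1) - M.q n ≤ M.q (n + 2) - M.q (n + 1)) {a b : ℕ}
    (hab : a ≤ b) : b < N → M.marginal a ≤ M.marginal b := by
  induction hab with
  | refl => exact fun _ => le_rfl
  | step _ ih => exact fun hb => (ih (by omega)).trans (hq _ (by omega))

/-- Strategic complementarities: the gain from working increases with the opponents' probabilities
of working. The strategies need to be compared only at the signals that can occur, and one signal
may be left out because it has probability zero. -/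
theorem gain_mono (hq : ∀ n, n + 2 ≤ N → M.q (n + 1) - M.q n ≤ M.q (n + 2) - M.q (n + 1))
    {p p' : Fin N → ℝ → ℝ} (hp : IsStrategyVector p) (hp' : IsStrategyVector p')
    {ε : ℝ} (hε : 0 < ε) {v : Fin N → ℝ} {i : Fin N} (hv : 0 ≤ v i) {X : ℝ}
    (h : ∀ j, ∀ s ∈ M.signals ε, s ≠ X → p j s ≤ p' j s) (s : ℝ) :
    M.gain ε v p i s ≤ M.gain ε v p' i s := by
  have hmono : Monotone fun S : Finset {j : Fin N // j ≠ i} => M.marginal S.card :=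
    fun S T hST => M.marginal_mono hq (Finset.card_le_card hST) (card_lt T)
  refine setIntegral_mono_on (M.integrable_gain hp hε v i s) (M.integrable_gain hp' hε v i s)
    measurableSet_Icc fun x hx => ?_
  refine mul_le_mul_of_nonneg_left (add_le_add_right (mul_le_mul_of_nonneg_left ?_ hv) _)
    (M.weight_nonneg hε s x)
  refine bernoulliMean_mono_left (fun j => ?_) (fun j => ?_) (fun j => ?_) hmono
  · exact M.workProb_mem hp j ε x
  · exact M.workProb_mem hp' j ε x
  · exact M.workProb_mono hp hp' hε (h j) hx

theorem le_gain {p : Fin N → ℝ → ℝ} (hp : IsStrategyVector p) {ε : ℝ} (hε : 0 < ε)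
    {v : Fin N → ℝ} {i : Fin N} (hv : 0 ≤ v i) {d : ℝ} (hd : ∀ n < N, d ≤ M.marginal n) (s : ℝ) :
    (s - ε / 2 - M.cost i + v i * d) * M.signalDensity ε s ≤ M.gain ε v p i s := by
  rw [mul_comm, signalDensity, ← integral_mul_const]
  refine setIntegral_mono_on ((M.integrable_weight hε s).mul_const _)
    (M.integrable_gain hp hε v i s) measurableSet_Icc fun x _ => ?_
  by_cases hx : x ∈ Icc (s - ε / 2) (s + ε / 2)
  · refine mul_le_mul_of_nonneg_left ?_ (M.weight_nonneg hε s x)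
    have := mul_le_mul_of_nonneg_left (M.le_contribution hp i ε x hd) hv
    linarith [hx.1]
  · rw [M.weight_eq_zero hε hx, zero_mul, zero_mul]

theorem gain_le {p : Fin N → ℝ → ℝ} (hp : IsStrategyVector p) {ε : ℝ} (hε : 0 < ε)
    {v : Fin N → ℝ} {i : Fin N} (hv : 0 ≤ v i) {d : ℝ} (hd : ∀ n < N, M.marginal n ≤ d) (s : ℝ) :
    M.gain ε v p i s ≤ (s + ε / 2 - M.cost i + v i * d) * M.signalDensity ε s := by
  rw [mul_comm, signalDensity, ← integral_mul_const]
  refine setIntegral_mono_on (M.integrable_gain hp hε v i s)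
    ((M.integrable_weight hε s).mul_const _) measurableSet_Icc fun x _ => ?_
  by_cases hx : x ∈ Icc (s - ε / 2) (s + ε / 2)
  · refine mul_le_mul_of_nonneg_left ?_ (M.weight_nonneg hε s x)
    have := mul_le_mul_of_nonneg_left (M.contribution_le hp i ε x hd) hv
    linarith [hx.2]
  · rw [M.weight_eq_zero hε hx, zero_mul, zero_mul]

/-! ### Indifference at a common switching point -/

theorem mem_signals {ε x : ℝ} (hε : 0 < ε) (hx : x ∈ Icc M.lo M.hi) : x ∈ M.signals ε :=
  ⟨by linarith [hx.1], by linarith [hx.2]⟩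

/-- At the common switching point every agent is indifferent. -/
theorem gain_switching_eq_zero {ε : ℝ} (hε : 0 < ε) {v : Fin N → ℝ} {X : ℝ}
    (hX : X ∈ Icc M.lo M.hi) (h : M.IsBNE ε v (switching N X)) (i : Fin N) :
    M.gain ε v (switching N X) i X = 0 := by
  rw [M.isBNE_iff hε] at h
  have hs := M.mem_signals hε hX
  refine le_antisymm (not_lt.1 fun hpos => ?_) (not_lt.1 fun hneg => ?_)
  · have h1 := (M.continuous_gain h.1 hε v i).continuousAt.eventually (lt_mem_nhds hpos)
    have h2 : ∀ᶠ s in 𝓝 X, s ∈ M.signals ε := isOpen_Ioo.mem_nhds hs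
    have h3 : ∀ᶠ s in 𝓝[<] X, s < X := self_mem_nhdsWithin
    obtain ⟨s, ⟨hs1, hs2⟩, hs3⟩ := (((h1.and h2).filter_mono nhdsWithin_le_nhds).and h3).exists
    have := (h.2 i s hs2).1 hs1
    rw [switching_of_lt hs3] at this
    exact zero_ne_one this
  · have := (h.2 i X hs).2 hneg
    rw [switching_of_le le_rfl] at this
    exact one_ne_zero this

/-- The probability that a noise term is at least `t`. -/
def noiseTail (t : ℝ) : ℝ :=
  M.noiseLaw.real (Ici t)

/-- The expected marginal contribution of an agent whose noise term is `t`, when exactly those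
opponents work whose noise terms are at least `t`. -/
def rankContribution (t : ℝ) : ℝ :=
  ∑ k ∈ Finset.range N, (bernsteinPolynomial ℝ (N - 1) k).eval (M.noiseTail t) * M.marginal k

theorem workProb_switching {ε : ℝ} (hε : 0 < ε) (X x : ℝ) (j : Fin N) :
    M.workProb ε (switching N X j) x = M.noiseTail ((X - x) / ε) := by
  rw [noiseTail, ← integral_indicator_one measurableSet_Ici, workProb]
  refine integral_congr_ae (ae_of_all _ fun t => ?_)
  have : X ≤ x + ε * t ↔ (X - x) / ε ≤ t := by
    rw [div_le_iff₀ hε]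
    constructor <;> intro h <;> linarith
  simp [switching, indicator, this]

/-- When all agents switch at a common point, the contribution of an agent depends only on the
distance of the state from that point, and is the same for all agents. -/
theorem contribution_switching {ε : ℝ} (hε : 0 < ε) (X x : ℝ) (i : Fin N) :
    M.contribution ε (switching N X) i x = M.rankContribution ((X - x) / ε) := by
  simp only [contribution, M.workProb_switching hε]
  rw [bernoulliMean_card, card_opponents, rankContribution, Nat.sub_add_cancel i.pos]

theorem gain_switching {ε : ℝ} (hε : 0 < ε) (v : Fin N → ℝ) (i : Fin N) (X s : ℝ) :
    M.gain ε v (switching N X) i s = ∫ x in Icc M.lo M.hi,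
      M.weight ε s x * (x - M.cost i + v i * M.rankContribution ((X - x) / ε)) := by
  simp only [gain, M.contribution_switching hε]

/-- The indifference condition determines the reward from the cost: the gain is strictly increasing
in the reward. -/
theorem reward_unique {ε : ℝ} (hε : 0 < ε) {v v' : Fin N → ℝ} {X : ℝ} (hX : X ∈ Icc M.lo M.hi)
    {i j : Fin N} (hc : M.cost i = M.cost j) (h : M.gain ε v (switching N X) i X = 0)
    (h' : M.gain ε v' (switching N X) j X = 0) : v i = v' j := by
  obtain ⟨d, hd0, hd⟩ := M.exists_le_marginal
  have hp := isStrategyVector_switching (N := N) X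
  have hsub : M.gain ε v (switching N X) i X - M.gain ε v' (switching N X) j X =
      (v i - v' j) * ∫ x in Icc M.lo M.hi, M.weight ε X x * M.contribution ε (switching N X) i x := by
    rw [gain, gain, ← integral_sub (M.integrable_gain hp hε v i X)
      (M.integrable_gain hp hε v' j X), ← integral_const_mul]
    simp only [M.contribution_switching hε]
    congr 1
    ext x
    rw [hc]
    ring
  have hpos : 0 < ∫ x in Icc M.lo M.hi, M.weight ε X x * M.contribution ε (switching N X) i x := by
    refine (mul_pos (M.signalDensity_pos hε (M.mem_signals hε hX)) hd0).trans_le ?_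
    rw [signalDensity, ← integral_mul_const]
    refine setIntegral_mono_on ((M.integrable_weight hε X).mul_const _) ?_ measurableSet_Icc
      fun x _ => mul_le_mul_of_nonneg_left (M.le_contribution hp i ε x hd)
        (M.weight_nonneg hε X x)
    refine M.integrable_weight_mul hε X (M.measurable_contribution hp i ε) (C := 1) fun x _ => ?_
    have := M.contribution_mem hp i ε x
    rw [abs_of_nonneg this.1]
    exact this.2
  rw [h, h', sub_self, eq_comm] at hsub
  exact sub_eq_zero.1 ((mul_eq_zero.1 hsub).resolve_right hpos.ne')

/-! ### The gain at the switching point -/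

theorem measurable_rankContribution : Measurable M.rankContribution := by
  have h : Measurable M.noiseTail := by
    refine Antitone.measurable fun a b hab => ?_
    exact measureReal_mono (Ici_subset_Ici.2 hab)
  refine Finset.measurable_sum _ fun k _ => Measurable.mul_const ?_ _
  exact (Polynomial.continuous _).measurable.comp h

theorem rankContribution_mem (i : Fin N) (t : ℝ) : M.rankContribution t ∈ Icc (0 : ℝ) 1 := by
  have h := M.contribution_mem (isStrategyVector_switching t) i 1 0
  rwa [M.contribution_switching one_pos, sub_zero, div_one] at h

/-- Away from the boundary of the state space, the gain at the common switching point `X` is an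
integral over the own noise term `t = (X - x) / ε`, in which the beliefs about the opponents do not
depend on `X`. -/
theorem gain_switching_self {ε : ℝ} (hε : 0 < ε) (v : Fin N → ℝ) (i : Fin N) {X : ℝ}
    (hX : X ∈ Icc (M.lo + ε / 2) (M.hi - ε / 2)) :
    M.gain ε v (switching N X) i X =
      ∫ t, M.f t * (M.prior (X - ε * t) * (X - ε * t - M.cost i + v i * M.rankContribution t)) := by
  rw [M.gain_switching hε, setIntegral_eq_integral_of_forall_compl_eq_zero fun x hx => ?_]
  · set F : ℝ → ℝ := fun t =>
      M.f t * (M.prior (X - ε * t) * (X - ε * t - M.cost i + v i * M.rankContribution t))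
    have h1 : ∀ x, M.weight ε X x * (x - M.cost i + v i * M.rankContribution ((X - x) / ε)) =
        ε⁻¹ * F ((X - x) / ε) := fun x => by
      simp only [F, weight, mul_div_cancel₀ _ hε.ne', sub_sub_cancel]
      ring
    simp only [h1]
    rw [integral_const_mul, integral_sub_left_eq_self (fun x => F (x / ε)) volume X,
      Measure.integral_comp_div, abs_of_pos hε, smul_eq_mul, inv_mul_cancel_left₀ hε.ne']
  · rw [M.weight_eq_zero hε fun h => hx ⟨by linarith [h.1, hX.1], by linarith [h.2, hX.2]⟩, zero_mul]

/-! ### Uniform rank beliefs -/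

theorem noiseTail_eq {t : ℝ} (ht : t ≤ 1 / 2) : M.noiseTail t = -∫ u in (1 / 2)..t, M.f u := by
  have h1 : M.noiseTail t = ∫ u in Ici t, M.f u := by
    rw [noiseTail, ← integral_indicator_one measurableSet_Ici, integral_noiseLaw,
      ← integral_indicator measurableSet_Ici]
    congr 1
    ext u
    by_cases hu : u ∈ Ici t <;> simp [hu]
  rw [h1, ← intervalIntegral.integral_symm, intervalIntegral.integral_of_le ht,
    ← integral_Icc_eq_integral_Ioc]
  refine setIntegral_eq_of_subset_of_forall_sdiff_eq_zero measurableSet_Ici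
    (fun u hu => hu.1) fun u hu => M.f_eq_zero fun h => hu.2 ⟨hu.1, h.2⟩

/-- The noise term is atomless, so its tail probability is uniformly distributed; hence the rank of
an agent among all agents is uniform, and his expected marginal contribution is `qbar`. -/
theorem integral_rankContribution (hN : 0 < N) : ∫ t, M.f t * M.rankContribution t = M.qbar := by
  set P : ℝ → ℝ := fun u =>
    ∑ k ∈ Finset.range N, (bernsteinPolynomial ℝ (N - 1) k).eval u * M.marginal k with hP
  have hPc : Continuous P :=
    continuous_finsetSum _ fun k _ => (Polynomial.continuous _).mul continuous_const
  have hQ : ∀ u, HasDerivAt (fun u => ∫ w in (0 : ℝ)..u, P w) (P u) u := fun u =>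
    intervalIntegral.integral_hasDerivAt_right (hPc.intervalIntegrable _ _)
      hPc.stronglyMeasurable.stronglyMeasurableAtFilter hPc.continuousAt
  have hfi : ∀ a b, IntervalIntegrable M.f volume a b := fun a b =>
    M.integrable_f.intervalIntegrable
  set T : ℝ → ℝ := fun t => -∫ u in (1 / 2)..t, M.f u with hT
  have hTc : Continuous T := (intervalIntegral.continuous_primitive hfi _).neg
  have hTtail : ∀ t ≤ 1 / 2, M.noiseTail t = T t := fun t ht => M.noiseTail_eq ht
  have hTd : ∀ t ∈ Ioo (-1 / 2 : ℝ) (1 / 2), HasDerivAt T (-M.f t) t := fun t ht =>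
    (intervalIntegral.integral_hasDerivAt_right (hfi _ _)
      M.measurable_f.stronglyMeasurable.stronglyMeasurableAtFilter
      (M.continuousAt_f ht.1.ne' ht.2.ne)).neg
  have hT1 : T (-1 / 2) = 1 := by
    rw [← hTtail _ (by norm_num), noiseTail, measureReal_def,
      prob_compl_eq_zero_iff measurableSet_Ici |>.1 ?_, ENNReal.toReal_one]
    filter_upwards [M.ae_noiseLaw_mem_Icc] with t ht using ht.1
  have hT0 : T (1 / 2) = 0 := by simp [hT]
  have hmain : ∫ t in (-1 / 2 : ℝ)..(1 / 2), P (T t) * -M.f t =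
      (∫ w in (0 : ℝ)..T (1 / 2), P w) - ∫ w in (0 : ℝ)..T (-1 / 2), P w := by
    refine intervalIntegral.integral_eq_sub_of_hasDerivAt_of_le (by norm_num)
      (f := fun t => ∫ w in (0 : ℝ)..T t, P w) ?_ (fun t ht => (hQ (T t)).comp t (hTd t ht))
      ((hfi _ _).neg.continuousOn_mul (hPc.comp hTc).continuousOn)
    exact ((continuous_iff_continuousAt.2 fun u => (hQ u).continuousAt).comp hTc).continuousOn
  rw [hT0, hT1, intervalIntegral.integral_same, zero_sub] at hmain
  have h1 : ∫ t, M.f t * M.rankContribution t = ∫ t in (-1 / 2 : ℝ)..(1 / 2), P (T t) * M.f t := by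
    rw [intervalIntegral.integral_of_le (by norm_num), ← integral_Icc_eq_integral_Ioc,
      ← setIntegral_eq_integral_of_forall_compl_eq_zero (s := Icc (-1 / 2 : ℝ) (1 / 2))
        fun t ht => by rw [M.f_eq_zero ht, zero_mul]]
    refine setIntegral_congr_fun measurableSet_Icc fun t ht => ?_
    simp only [rankContribution, hTtail t ht.2, hP]
    rw [mul_comm]
  simp only [mul_neg, intervalIntegral.integral_neg, neg_inj] at hmain
  rw [h1, hmain, qbar]
  have h2 := integral_sum_bernstein (N - 1) M.marginal
  rw [Nat.sub_add_cancel hN] at h2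
  rw [h2]
  have h3 : ((N - 1 : ℕ) : ℝ) + 1 = N := by exact_mod_cast Nat.sub_add_cancel hN
  rw [h3]
  rfl

theorem qbar_pos (hN : 0 < N) : 0 < M.qbar := by
  refine Finset.sum_pos (fun n hn => ?_) ⟨0, by simpa⟩
  exact div_pos (M.marginal_pos (by simpa using hn)) (by exact_mod_cast hN)

/-! ### The limit of vanishing noise -/

/-- The posterior of the own noise term converges to its prior law as the noise vanishes. -/
theorem tendsto_integral_prior {k : ℝ → ℝ} (hk : Integrable fun t => M.f t * k t) (X : ℝ) :
    Tendsto (fun ε => ∫ t, M.f t * (M.prior (X - ε * t) * k t)) (𝓝 0)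
      (𝓝 (M.prior X * ∫ t, M.f t * k t)) := by
  obtain ⟨C, hC⟩ := M.exists_prior_le
  have hc := M.continuous_prior
  rw [← integral_const_mul]
  have heq : ∀ ε t, M.f t * (M.prior (X - ε * t) * k t) = M.prior (X - ε * t) * (M.f t * k t) :=
    fun ε t => by ring
  simp only [heq]
  refine tendsto_integral_filter_of_dominated_convergence (fun t => C * |M.f t * k t|)
    (Eventually.of_forall fun ε => ?_) (Eventually.of_forall fun ε => ae_of_all _ fun t => ?_)
    (hk.abs.const_mul C) (ae_of_all _ fun t => ?_)
  · exact (hc.comp (by fun_prop)).aestronglyMeasurable.mul hk.1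
  · rw [norm_mul, Real.norm_eq_abs, Real.norm_eq_abs, abs_of_pos (M.prior_pos _)]
    exact mul_le_mul_of_nonneg_right (hC _) (abs_nonneg _)
  · refine Tendsto.mul_const _ ?_
    have : Continuous fun ε => M.prior (X - ε * t) := hc.comp (by fun_prop)
    simpa using this.tendsto 0

theorem integrable_f_mul {k : ℝ → ℝ} (hk : Measurable k) {C : ℝ}
    (hC : ∀ t ∈ Icc (-1 / 2 : ℝ) (1 / 2), |k t| ≤ C) : Integrable fun t => M.f t * k t := by
  refine (M.integrable_f.const_mul C).mono' (M.measurable_f.mul hk).aestronglyMeasurable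
    (ae_of_all _ fun t => ?_)
  by_cases ht : t ∈ Icc (-1 / 2 : ℝ) (1 / 2)
  · rw [norm_mul, Real.norm_eq_abs, Real.norm_eq_abs, abs_of_nonneg (M.f_nonneg t), mul_comm]
    exact mul_le_mul_of_nonneg_right (hC t ht) (M.f_nonneg t)
  · simp [M.f_eq_zero ht]

theorem integrable_prior_mul {k : ℝ → ℝ} (hk : Integrable fun t => M.f t * k t) (ε X : ℝ) :
    Integrable fun t => M.f t * (M.prior (X - ε * t) * k t) := by
  obtain ⟨C, hC⟩ := M.exists_prior_le
  have heq : (fun t => M.f t * (M.prior (X - ε * t) * k t)) =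
      fun t => M.prior (X - ε * t) * (M.f t * k t) := by
    ext t
    ring
  rw [heq]
  refine hk.bdd_mul (c := C)
    (M.continuous_prior.comp (by fun_prop)).aestronglyMeasurable (ae_of_all _ fun t => ?_)
  rw [Real.norm_eq_abs, abs_of_pos (M.prior_pos _)]
  exact hC _

theorem integrable_f_mul_id : Integrable fun t => M.f t * t :=
  M.integrable_f_mul (k := fun t => t) measurable_id (C := 1 / 2) fun t ht => by
    rw [abs_le]
    constructor <;> linarith [ht.1, ht.2]

theorem integrable_f_mul_rankContribution (hN : 0 < N) :
    Integrable fun t => M.f t * M.rankContribution t :=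
  M.integrable_f_mul M.measurable_rankContribution (C := 1) fun t _ => by
    have := M.rankContribution_mem ⟨0, hN⟩ t
    rw [abs_of_nonneg this.1]
    exact this.2

/-- The reward that makes agent `i` indifferent at the common switching point `X`. -/
def indifferenceReward (ε X : ℝ) (i : Fin N) : ℝ :=
  ((M.cost i - X) * (∫ t, M.f t * (M.prior (X - ε * t) * 1)) +
    ε * ∫ t, M.f t * (M.prior (X - ε * t) * t)) /
      ∫ t, M.f t * (M.prior (X - ε * t) * M.rankContribution t)

theorem tendsto_indifferenceReward (X : ℝ) (i : Fin N) :
    Tendsto (fun ε => M.indifferenceReward ε X i) (𝓝 0) (𝓝 ((M.cost i - X) / M.qbar)) := by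
  have hN := i.pos
  have h1 := M.tendsto_integral_prior (k := fun _ => 1) (by simpa using M.integrable_f) X
  have h2 := M.tendsto_integral_prior M.integrable_f_mul_id X
  have h3 := M.tendsto_integral_prior (M.integrable_f_mul_rankContribution hN) X
  rw [M.integral_rankContribution hN] at h3
  have hX := M.prior_pos X
  have h4 := ((h1.const_mul (M.cost i - X)).add (tendsto_id.mul h2)).div h3
    (mul_pos hX (M.qbar_pos hN)).ne'
  have hlim : (M.cost i - X) / M.qbar = ((M.cost i - X) * (M.prior X * ∫ t, M.f t * 1) +
      0 * (M.prior X * ∫ t, M.f t * t)) / (M.prior X * M.qbar) := by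
    simp only [mul_one, M.f_int, zero_mul, add_zero]
    rw [mul_comm (M.prior X), mul_div_mul_right _ _ hX.ne']
  rw [hlim]
  exact h4

/-- For small noise, indifference at `X` is the same as being paid the indifference reward. -/
theorem eventually_gain_eq_zero_iff {X : ℝ} (hX : X ∈ Ioo M.lo M.hi) :
    ∀ᶠ ε in 𝓝[>] (0 : ℝ), ∀ (v : Fin N → ℝ) (i : Fin N),
      M.gain ε v (switching N X) i X = 0 ↔ v i = M.indifferenceReward ε X i := by
  rcases Nat.eq_zero_or_pos N with rfl | hN
  · exact Eventually.of_forall fun ε v i => i.elim0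
  have h3 := M.tendsto_integral_prior (M.integrable_f_mul_rankContribution hN) X
  rw [M.integral_rankContribution hN] at h3
  have h4 := (h3.eventually (lt_mem_nhds (mul_pos (M.prior_pos X) (M.qbar_pos hN)))).filter_mono
    (nhdsWithin_le_nhds (s := Ioi 0))
  have h5 : ∀ᶠ ε in 𝓝[>] (0 : ℝ), ε < min (X - M.lo) (M.hi - X) :=
    (gt_mem_nhds (lt_min (sub_pos.2 hX.1) (sub_pos.2 hX.2))).filter_mono nhdsWithin_le_nhds
  filter_upwards [h4, h5, self_mem_nhdsWithin] with ε hA hε1 (hε : 0 < ε) v i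
  rw [lt_min_iff] at hε1
  rw [M.gain_switching_self hε v i ⟨by linarith, by linarith⟩]
  have i1 := M.integrable_prior_mul (k := fun _ => 1) (by simpa using M.integrable_f) ε X
  have i2 := M.integrable_prior_mul M.integrable_f_mul_id ε X
  have i3 := M.integrable_prior_mul (M.integrable_f_mul_rankContribution hN) ε X
  have heq : ∀ t, M.f t * (M.prior (X - ε * t) *
      (X - ε * t - M.cost i + v i * M.rankContribution t)) =
      (X - M.cost i) * (M.f t * (M.prior (X - ε * t) * 1)) -
        ε * (M.f t * (M.prior (X - ε * t) * t)) +
        v i * (M.f t * (M.prior (X - ε * t) * M.rankContribution t)) := fun t => by ring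
  simp only [heq]
  have i12 : Integrable fun t => (X - M.cost i) * (M.f t * (M.prior (X - ε * t) * 1)) -
      ε * (M.f t * (M.prior (X - ε * t) * t)) := (i1.const_mul _).sub (i2.const_mul _)
  rw [integral_add i12 (i3.const_mul _),
    integral_sub (i1.const_mul _) (i2.const_mul _), integral_const_mul, integral_const_mul,
    integral_const_mul, indifferenceReward, eq_div_iff hA.ne']
  constructor <;> intro h <;> linarith

/-! ### Single crossing of the gain at the switching point -/

/-- Log differences of the prior density over distances of the order of the noise vary slowly with
the location, because the derivative of its logarithm is uniformly continuous. -/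
theorem eventually_abs_log_prior_sub_le (hg : ContDiffOn ℝ 1 M.g (Icc M.lo M.hi)) {ω : ℝ}
    (hω : 0 < ω) : ∀ᶠ ε in 𝓝[>] (0 : ℝ), ∀ t ∈ Icc (-1 / 2 : ℝ) (1 / 2),
      ∀ X ∈ Icc (M.lo + ε / 2) (M.hi - ε / 2), ∀ Y ∈ Icc (M.lo + ε / 2) (M.hi - ε / 2),
      |(Real.log (M.prior (X - ε * t)) - Real.log (M.prior X)) -
        (Real.log (M.prior (Y - ε * t)) - Real.log (M.prior Y))| ≤ ω * |X - Y| := by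
  set φ : ℝ → ℝ := fun x => Real.log (M.prior x)
  set K := Icc M.lo M.hi
  have hφ : ContDiffOn ℝ 1 φ K :=
    (hg.congr fun x hx => M.prior_eq hx).log fun x _ => (M.prior_pos x).ne'
  have hu : UniqueDiffOn ℝ K := uniqueDiffOn_Icc M.lo_lt_hi
  have hd : ∀ x ∈ K, HasDerivWithinAt φ (derivWithin φ K x) K x := fun x hx =>
    ((hφ.differentiableOn one_ne_zero) x hx).hasDerivWithinAt
  have hcont : ContinuousOn (derivWithin φ K) K := hφ.continuousOn_derivWithin hu le_rfl
  obtain ⟨ρ, hρ, hunif⟩ := Metric.uniformContinuousOn_iff.1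
    (isCompact_Icc.uniformContinuousOn_of_continuous hcont) ω hω
  have hsmall : ∀ᶠ ε in 𝓝[>] (0 : ℝ), ε < ρ := (gt_mem_nhds hρ).filter_mono nhdsWithin_le_nhds
  filter_upwards [hsmall, self_mem_nhdsWithin] with ε hερ (hε : 0 < ε) t ht X hX Y hY
  set I := Icc (M.lo + ε / 2) (M.hi - ε / 2)
  have habs : |ε * t| ≤ ε / 2 := by
    rw [abs_le]
    constructor <;> nlinarith [ht.1, ht.2]
  have hmaps : MapsTo (fun x => x - ε * t) I K := fun x hx =>
    ⟨by linarith [hx.1, (abs_le.1 habs).2], by linarith [hx.2, (abs_le.1 habs).1]⟩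
  have hsub : I ⊆ K := Icc_subset_Icc (by linarith) (by linarith)
  have hder : ∀ x ∈ I, HasDerivWithinAt (fun x => φ (x - ε * t) - φ x)
      (derivWithin φ K (x - ε * t) - derivWithin φ K x) I x := fun x hx => by
    have h1 := (hd _ (hmaps hx)).comp x ((hasDerivWithinAt_id x I).sub_const (ε * t)) hmaps
    rw [mul_one] at h1
    exact h1.sub ((hd x (hsub hx)).mono hsub)
  have hbound : ∀ x ∈ I, ‖derivWithin φ K (x - ε * t) - derivWithin φ K x‖ ≤ ω := fun x hx => by
    have h1 := hunif _ (hmaps hx) _ (hsub hx) (by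
      rw [Real.dist_eq, sub_sub_cancel_left, abs_neg]
      linarith)
    rw [Real.dist_eq] at h1
    exact h1.le
  exact (convex_Icc _ _).norm_image_sub_le_of_norm_hasDerivWithin_le hder hbound hY hX

theorem integral_prior_pos (ε X : ℝ) : 0 < ∫ t, M.f t * (M.prior (X - ε * t) * 1) := by
  have h1 : 0 < volume (Function.support M.f) :=
    (integral_pos_iff_support_of_nonneg M.f_nonneg M.integrable_f).1 (M.f_int ▸ one_pos)
  rw [integral_pos_iff_support_of_nonneg
    (fun t => mul_nonneg (M.f_nonneg t) (mul_nonneg (M.prior_pos _).le zero_le_one))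
    (M.integrable_prior_mul (k := fun _ => 1) (by simpa using M.integrable_f) ε X)]
  convert h1 using 2
  ext t
  simp [(M.prior_pos _).ne']

/-- If an agent is indifferent when the common switching point is `Y`, then he strictly prefers to
work when it is higher, and to shirk when it is lower. Moving the switching point from `Y` to `X`
shifts the expected state by about `X - Y`, while the posterior of the own noise term changes by a
small multiple `ω * |X - Y|` only. -/
theorem gain_switching_self_sign {ε : ℝ} (hε : 0 < ε) {v : Fin N → ℝ} {i : Fin N} {B ω : ℝ}
    (hω0 : 0 ≤ ω) {X Y : ℝ} (hX : X ∈ Icc (M.lo + ε / 2) (M.hi - ε / 2))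
    (hY : Y ∈ Icc (M.lo + ε / 2) (M.hi - ε / 2))
    (hB : ∀ t ∈ Icc (-1 / 2 : ℝ) (1 / 2),
      |Y - ε * t - M.cost i + v i * M.rankContribution t| ≤ B)
    (hω : 4 * (ω * (M.hi - M.lo + B)) ≤ 1)
    (hlog : ∀ t ∈ Icc (-1 / 2 : ℝ) (1 / 2),
      |(Real.log (M.prior (X - ε * t)) - Real.log (M.prior X)) -
        (Real.log (M.prior (Y - ε * t)) - Real.log (M.prior Y))| ≤ ω * |X - Y|)
    (hY0 : M.gain ε v (switching N Y) i Y = 0) :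
    (Y < X → 0 < M.gain ε v (switching N X) i X) ∧
      (X < Y → M.gain ε v (switching N X) i X < 0) := by
  rw [M.gain_switching_self hε v i hX]
  rw [M.gain_switching_self hε v i hY] at hY0
  set A := M.rankContribution
  set k : ℝ → ℝ := fun t => Y - ε * t - M.cost i + v i * A t with hk
  have hB0 : 0 ≤ B := (abs_nonneg _).trans (hB 0 (by norm_num))
  have hXY : |X - Y| ≤ M.hi - M.lo := by
    rw [abs_le]
    constructor <;> linarith [hX.1, hX.2, hY.1, hY.2]
  have hωXY : ω * |X - Y| ≤ 1 := by
    have h1 := mul_le_mul_of_nonneg_left hXY hω0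
    have h2 := mul_nonneg hω0 hB0
    linarith
  set r := M.prior X / M.prior Y with hr
  have hr0 : 0 < r := div_pos (M.prior_pos X) (M.prior_pos Y)
  -- the ratio of the two posterior densities is `r * (1 + e)` with a small `e`
  have hratio : ∀ t ∈ Icc (-1 / 2 : ℝ) (1 / 2), ∃ e : ℝ, |e| ≤ 2 * (ω * |X - Y|) ∧
      M.prior (X - ε * t) = r * (M.prior (Y - ε * t) * (1 + e)) := fun t ht => by
    set z := (Real.log (M.prior (X - ε * t)) - Real.log (M.prior X)) -
        (Real.log (M.prior (Y - ε * t)) - Real.log (M.prior Y)) with hz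
    refine ⟨Real.exp z - 1, (Real.abs_exp_sub_one_le ((hlog t ht).trans hωXY)).trans
      (mul_le_mul_of_nonneg_left (hlog t ht) zero_le_two), ?_⟩
    have h1 := M.prior_pos X
    have h2 := M.prior_pos Y
    have h3 := M.prior_pos (Y - ε * t)
    rw [add_sub_cancel, hz, Real.exp_sub, Real.exp_sub, Real.exp_sub, Real.exp_log h1,
      Real.exp_log h2, Real.exp_log h3, Real.exp_log (M.prior_pos _), hr]
    field_simp
  have herr : ∀ t ∈ Icc (-1 / 2 : ℝ) (1 / 2), ∃ e : ℝ, |e| ≤ |X - Y| / 2 ∧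
      M.prior (X - ε * t) * (X - ε * t - M.cost i + v i * A t) =
        r * (M.prior (Y - ε * t) * (k t + (X - Y) + e)) := fun t ht => by
    obtain ⟨e, he, heq⟩ := hratio t ht
    refine ⟨e * (X - Y + k t), ?_, ?_⟩
    · have h1 : |X - Y + k t| ≤ M.hi - M.lo + B :=
        (abs_add_le _ _).trans (add_le_add hXY (hB t ht))
      have h2 := mul_le_mul he h1 (abs_nonneg _)
        (mul_nonneg zero_le_two (mul_nonneg hω0 (abs_nonneg _)))
      have h3 := mul_le_mul_of_nonneg_right hω (abs_nonneg (X - Y))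
      rw [abs_mul]
      linarith
    · rw [heq, hk]
      ring
  have ik : Integrable fun t => M.f t * k t := by
    have h1 := M.measurable_rankContribution
    exact M.integrable_f_mul (by fun_prop) hB
  have i0 := M.integrable_prior_mul ik ε Y
  have i1 := M.integrable_prior_mul (k := fun _ => 1) (by simpa using M.integrable_f) ε Y
  have iX : Integrable fun t => M.f t *
      (M.prior (X - ε * t) * (X - ε * t - M.cost i + v i * A t)) := by
    refine M.integrable_prior_mul (k := fun t => X - ε * t - M.cost i + v i * A t) ?_ ε X
    have h1 : (fun t => M.f t * (X - ε * t - M.cost i + v i * A t)) =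
        fun t => (X - Y) * M.f t + M.f t * k t := by
      ext t
      simp only [hk]
      ring
    rw [h1]
    exact (M.integrable_f.const_mul _).add ik
  have hZ := M.integral_prior_pos ε Y
  have hcmp : ∫ t, r * (M.f t * (M.prior (Y - ε * t) * k t) +
      (X - Y) / 2 * (M.f t * (M.prior (Y - ε * t) * 1))) =
      r * ((X - Y) / 2 * ∫ t, M.f t * (M.prior (Y - ε * t) * 1)) := by
    rw [integral_const_mul, integral_add i0 (i1.const_mul _), hY0, zero_add, integral_const_mul]
  constructor
  · intro hlt
    refine lt_of_lt_of_le (mul_pos hr0 (mul_pos (half_pos (sub_pos.2 hlt)) hZ))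
      (hcmp.symm.trans_le (integral_mono ((i0.add (i1.const_mul _)).const_mul r) iX fun t => ?_))
    by_cases ht : t ∈ Icc (-1 / 2 : ℝ) (1 / 2)
    · obtain ⟨e, he, heq⟩ := herr t ht
      rw [abs_of_pos (sub_pos.2 hlt), abs_le] at he
      have h1 := mul_nonneg (mul_nonneg hr0.le (mul_nonneg (M.f_nonneg t)
        (M.prior_pos (Y - ε * t)).le)) (show 0 ≤ (X - Y) / 2 + e by linarith [he.1])
      simp only [heq]
      linarith
    · simp [M.f_eq_zero ht]
  · intro hlt
    refine lt_of_le_of_lt ((integral_mono iX ((i0.add (i1.const_mul _)).const_mul r)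
      fun t => ?_).trans_eq hcmp) (mul_neg_of_pos_of_neg hr0
        (mul_neg_of_neg_of_pos (by linarith) hZ))
    by_cases ht : t ∈ Icc (-1 / 2 : ℝ) (1 / 2)
    · obtain ⟨e, he, heq⟩ := herr t ht
      rw [abs_of_neg (sub_neg.2 hlt), abs_le] at he
      have h1 := mul_nonneg (mul_nonneg hr0.le (mul_nonneg (M.f_nonneg t)
        (M.prior_pos (Y - ε * t)).le)) (show 0 ≤ -((X - Y) / 2 + e) by linarith [he.2])
      simp only [heq, Pi.add_apply]
      linarith
    · simp [M.f_eq_zero ht]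

/-- For small noise, if every agent is indifferent at the common switching point `Y` and rewards are
bounded, then `Y` is the only common switching point at which an agent is indifferent. -/
theorem eventually_gain_switching_self_sign (hg : ContDiffOn ℝ 1 M.g (Icc M.lo M.hi)) {Y : ℝ}
    (hY : Y ∈ Ioo M.lo M.hi) (i : Fin N) {C : ℝ} (hC : 0 ≤ C) :
    ∀ᶠ ε in 𝓝[>] (0 : ℝ), ∀ v : Fin N → ℝ, |v i| ≤ C → M.gain ε v (switching N Y) i Y = 0 →
      ∀ X ∈ Icc (M.lo + ε / 2) (M.hi - ε / 2),
        (Y < X → 0 < M.gain ε v (switching N X) i X) ∧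
        (X < Y → M.gain ε v (switching N X) i X < 0) := by
  set B := |Y| + 1 + |M.cost i| + C
  have hLB : 0 < M.hi - M.lo + B := by
    have := sub_pos.2 M.lo_lt_hi
    positivity
  have hω : 0 < 1 / (4 * (M.hi - M.lo + B)) := by positivity
  have hsmall : ∀ᶠ ε in 𝓝[>] (0 : ℝ), ε < min 1 (min (Y - M.lo) (M.hi - Y)) :=
    (gt_mem_nhds (lt_min one_pos (lt_min (sub_pos.2 hY.1) (sub_pos.2 hY.2)))).filter_mono
      nhdsWithin_le_nhds
  filter_upwards [M.eventually_abs_log_prior_sub_le hg hω, hsmall, self_mem_nhdsWithin]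
    with ε hlog hε1 (hε : 0 < ε) v hv hY0 X hX
  rw [lt_min_iff, lt_min_iff] at hε1
  have hYI : Y ∈ Icc (M.lo + ε / 2) (M.hi - ε / 2) := ⟨by linarith, by linarith⟩
  refine M.gain_switching_self_sign hε (B := B) hω.le hX hYI (fun t ht => ?_) ?_
    (fun t ht => hlog t ht X hX Y hYI) hY0
  · have h1 := M.rankContribution_mem i t
    have h2 : |v i * M.rankContribution t| ≤ C := by
      rw [abs_mul, abs_of_nonneg h1.1]
      exact (mul_le_of_le_one_right (abs_nonneg _) h1.2).trans hv
    have h3 : |ε * t| ≤ 1 := by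
      rw [abs_le]
      constructor <;> nlinarith [ht.1, ht.2]
    refine (abs_add_le _ _).trans (add_le_add ?_ h2)
    exact (abs_sub _ _).trans (add_le_add_left ((abs_sub _ _).trans (add_le_add_right h3 _)) _)
  · field_simp
    rfl

/-! ### Contagion -/

section Contagion

variable {ε : ℝ} {v : Fin N → ℝ} {Y : ℝ}

/-- Contagion from above: if the opponents work at all signals above `X > Y`, then working is
strictly optimal at `X`. From `hi - ε / 2` on, working is dominant, so nothing is assumed about the
opponents there. -/
theorem gain_pos_of_forall_gt
    (hq : ∀ n, n + 2 ≤ N → M.q (n + 1) - M.q n ≤ M.q (n + 2) - M.q (n + 1)) (hε : 0 < ε)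
    (hv : ∀ i, 0 ≤ v i) (hY : Y ∈ Icc (M.lo + ε / 2) (M.hi - ε / 2))
    (hU : ∀ i, 0 < M.hi - ε - M.cost i + v i * M.marginal 0)
    (hpos : ∀ i, ∀ X ∈ Icc (M.lo + ε / 2) (M.hi - ε / 2), Y < X →
      0 < M.gain ε v (switching N X) i X)
    {p : Fin N → ℝ → ℝ} (hp : IsStrategyVector p) {X : ℝ} (hX : X ∈ M.signals ε) (hXY : Y < X)
    (h : X < M.hi - ε / 2 → ∀ j, ∀ s ∈ M.signals ε, X < s → p j s = 1) (i : Fin N) :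
    0 < M.gain ε v p i X := by
  rcases lt_or_ge X (M.hi - ε / 2) with hlt | hge
  · refine (hpos i X ⟨by linarith [hY.1], hlt.le⟩ hXY).trans_le
      (M.gain_mono hq (isStrategyVector_switching X) hp hε (hv i) (X := X) (fun j s hs hne => ?_) X)
    rcases lt_or_gt_of_ne hne with h1 | h1
    · rw [switching_of_lt h1]
      exact ((hp j).2 s).1
    · rw [h hlt j s hs h1]
      exact ((isStrategyVector_switching X j).2 s).2
  · refine lt_of_lt_of_le (mul_pos ?_ (M.signalDensity_pos hε hX)) (M.le_gain hp hε (hv i)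
      (fun n hn => M.marginal_mono hq (Nat.zero_le n) hn) X)
    linarith [hU i]

/-- Contagion from below: if the opponents shirk at all signals below `X < Y`, then shirking is
strictly optimal at `X`. Up to `lo + ε / 2`, shirking is dominant, so nothing is assumed about the
opponents there. -/
theorem gain_neg_of_forall_lt
    (hq : ∀ n, n + 2 ≤ N → M.q (n + 1) - M.q n ≤ M.q (n + 2) - M.q (n + 1)) (hε : 0 < ε)
    (hv : ∀ i, 0 ≤ v i) (hY : Y ∈ Icc (M.lo + ε / 2) (M.hi - ε / 2))
    (hL : ∀ i, M.lo + ε - M.cost i + v i * M.marginal (N - 1) < 0)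
    (hneg : ∀ i, ∀ X ∈ Icc (M.lo + ε / 2) (M.hi - ε / 2), X < Y →
      M.gain ε v (switching N X) i X < 0)
    {p : Fin N → ℝ → ℝ} (hp : IsStrategyVector p) {X : ℝ} (hX : X ∈ M.signals ε) (hXY : X < Y)
    (h : M.lo + ε / 2 < X → ∀ j, ∀ s ∈ M.signals ε, s < X → p j s = 0) (i : Fin N) :
    M.gain ε v p i X < 0 := by
  rcases lt_or_ge (M.lo + ε / 2) X with hlt | hge
  · refine lt_of_le_of_lt (M.gain_mono hq hp (isStrategyVector_switching X) hε (hv i) (X := X)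
      (fun j s hs hne => ?_) X) (hneg i X ⟨hlt.le, by linarith [hY.2]⟩ hXY)
    rcases lt_or_gt_of_ne hne with h1 | h1
    · rw [h hlt j s hs h1]
      exact ((isStrategyVector_switching X j).2 s).1
    · rw [switching_of_le h1.le]
      exact ((hp j).2 s).2
  · refine lt_of_le_of_lt (M.gain_le hp hε (hv i) (d := M.marginal (N - 1))
      (fun n hn => M.marginal_mono hq (by omega) (by omega)) X)
      (mul_neg_of_neg_of_pos ?_ (M.signalDensity_pos hε hX))
    linarith [hL i]

/-- Rewards implement the switching strategies at `Y` if each agent is indifferent at the common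
switching point `Y` and at no other one, and if there are dominance regions. -/
theorem implements_of_gain_sign
    (hq : ∀ n, n + 2 ≤ N → M.q (n + 1) - M.q n ≤ M.q (n + 2) - M.q (n + 1)) (hε : 0 < ε)
    (hv : ∀ i, 0 ≤ v i) (hY : Y ∈ Icc (M.lo + ε / 2) (M.hi - ε / 2))
    (hU : ∀ i, 0 < M.hi - ε - M.cost i + v i * M.marginal 0)
    (hL : ∀ i, M.lo + ε - M.cost i + v i * M.marginal (N - 1) < 0)
    (hY0 : ∀ i, M.gain ε v (switching N Y) i Y = 0)
    (hpos : ∀ i, ∀ X ∈ Icc (M.lo + ε / 2) (M.hi - ε / 2), Y < X →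
      0 < M.gain ε v (switching N X) i X)
    (hneg : ∀ i, ∀ X ∈ Icc (M.lo + ε / 2) (M.hi - ε / 2), X < Y →
      M.gain ε v (switching N X) i X < 0) :
    M.Implements ε v Y := by
  have hup := fun {p : Fin N → ℝ → ℝ} (hp : IsStrategyVector p) {X : ℝ} =>
    M.gain_pos_of_forall_gt hq hε hv hY hU hpos hp (X := X)
  have hdown := fun {p : Fin N → ℝ → ℝ} (hp : IsStrategyVector p) {X : ℝ} =>
    M.gain_neg_of_forall_lt hq hε hv hY hL hneg hp (X := X)
  constructor
  · rw [M.isBNE_iff hε]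
    have hsw := isStrategyVector_switching (N := N) Y
    refine ⟨hsw, fun i s hs => ?_⟩
    rcases lt_trichotomy s Y with h | rfl | h
    · have h1 := hdown hsw hs h (fun _ j s' _ hs' => switching_of_lt (hs'.trans h) j) i
      exact ⟨fun h2 => absurd h2 h1.not_gt, fun _ => switching_of_lt h i⟩
    · rw [hY0 i]
      exact ⟨fun h => absurd h (lt_irrefl _), fun h => absurd h (lt_irrefl _)⟩
    · have h1 := hup hsw hs h (fun _ j s' _ hs' => switching_of_le (h.trans hs').le j) i
      exact ⟨fun _ => switching_of_le h.le i, fun h2 => absurd h2 h1.not_gt⟩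
  · intro p hBNE
    rw [M.isBNE_iff hε] at hBNE
    obtain ⟨hp, hbest⟩ := hBNE
    have hcont : ∀ i, Continuous (M.gain ε v p i) := M.continuous_gain hp hε v
    -- the supremum of the signals above `Y` at which some agent may shirk
    have habove : ∀ s ∈ M.signals ε, Y < s → ∀ j, p j s = 1 := by
      by_contra! hcon
      set A := {s | s ∈ M.signals ε ∧ Y < s ∧ ∃ j, p j s ≠ 1}
      obtain ⟨s₀, hs₀, hYs₀, j₀, hj₀⟩ := hcon
      have hAne : A.Nonempty := ⟨s₀, hs₀, hYs₀, j₀, hj₀⟩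
      have hAle : ∀ s ∈ A, s ≤ M.hi - ε / 2 := fun s ⟨hs, hYs, j, hj⟩ => by
        by_contra! hlt
        exact hj ((hbest j s hs).1 (hup hp hs hYs (fun h => absurd h hlt.not_gt) j))
      have hbdd : BddAbove A := ⟨_, hAle⟩
      set X := sSup A
      have hYX : Y < X := hYs₀.trans_le (le_csSup hbdd ⟨hs₀, hYs₀, j₀, hj₀⟩)
      have hXs : X ∈ M.signals ε :=
        ⟨by linarith [hY.1], (csSup_le hAne hAle).trans_lt (by linarith)⟩
      have hgain := hup hp hXs hYX fun _ j s hs hXs' => by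
        by_contra hj
        exact (le_csSup hbdd ⟨hs, hYX.trans hXs', j, hj⟩).not_gt hXs'
      have hev : ∀ᶠ s in 𝓝 X, ∀ i, 0 < M.gain ε v p i s :=
        eventually_all.2 fun i => (hcont i).continuousAt.eventually (lt_mem_nhds (hgain i))
      obtain ⟨s, ⟨hs, -, j, hj⟩, hs'⟩ :=
        ((mem_closure_iff_frequently.1 (csSup_mem_closure hAne hbdd)).and_eventually hev).exists
      exact hj ((hbest j s hs).1 (hs' j))
    have hbelow : ∀ s ∈ M.signals ε, s < Y → ∀ j, p j s = 0 := by
      by_contra! hcon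
      set A := {s | s ∈ M.signals ε ∧ s < Y ∧ ∃ j, p j s ≠ 0}
      obtain ⟨s₀, hs₀, hYs₀, j₀, hj₀⟩ := hcon
      have hAne : A.Nonempty := ⟨s₀, hs₀, hYs₀, j₀, hj₀⟩
      have hAge : ∀ s ∈ A, M.lo + ε / 2 ≤ s := fun s ⟨hs, hYs, j, hj⟩ => by
        by_contra! hlt
        exact hj ((hbest j s hs).2 (hdown hp hs hYs (fun h => absurd h hlt.not_gt) j))
      have hbdd : BddBelow A := ⟨_, hAge⟩
      set X := sInf A
      have hYX : X < Y := (csInf_le hbdd ⟨hs₀, hYs₀, j₀, hj₀⟩).trans_lt hYs₀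
      have hXs : X ∈ M.signals ε :=
        ⟨lt_of_lt_of_le (by linarith) (le_csInf hAne hAge), by linarith [hY.2]⟩
      have hgain := hdown hp hXs hYX fun _ j s hs hXs' => by
        by_contra hj
        exact (csInf_le hbdd ⟨hs, hXs'.trans hYX, j, hj⟩).not_gt hXs'
      have hev : ∀ᶠ s in 𝓝 X, ∀ i, M.gain ε v p i s < 0 :=
        eventually_all.2 fun i => (hcont i).continuousAt.eventually (gt_mem_nhds (hgain i))
      obtain ⟨s, ⟨hs, -, j, hj⟩, hs'⟩ :=
        ((mem_closure_iff_frequently.1 (csInf_mem_closure hAne hbdd)).and_eventually hev).exists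
      exact hj ((hbest j s hs).2 (hs' j))
    intro i s hs hne
    rcases lt_or_gt_of_ne hne with h | h
    · rw [hbelow s hs h i, switching_of_lt h]
    · rw [habove s hs h i, switching_of_le h.le]

end Contagion

end PrincipalAgent

end

theorem proposition1 {N : ℕ} (M : PrincipalAgent N) (xt : ℝ) (hxt : xt ∈ Set.Ioo M.lo M.hi) :
    -- the implementing rewards satisfy `qbar * v i = cost i - xt` as the noise vanishes
    (∀ δ > 0, ∀ᶠ ε in 𝓝[>] (0 : ℝ), ∀ v : Fin N → ℝ, M.Implements ε v xt →
      ∀ i, |M.qbar * v i - (M.cost i - xt)| < δ) ∧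
    -- at most one reward scheme implements
    (∀ ε > 0, ∀ v v' : Fin N → ℝ, M.Implements ε v xt → M.Implements ε v' xt → v = v') ∧
    -- symmetric agents receive identical rewards
    (∀ ε > 0, ∀ v : Fin N → ℝ, M.Implements ε v xt →
      ∀ i j, M.cost i = M.cost j → v i = v j) ∧
    -- an implementing scheme exists for small noise: strategic complementarities, positive rewards,
    -- dominance regions inside the state space, continuously differentiable prior
    ((∀ n, n + 2 ≤ N → M.q (n + 1) - M.q n ≤ M.q (n + 2) - M.q (n + 1)) →
      (∀ i, xt < M.cost i) →
      (∀ i, M.lo < M.cost i - (M.cost i - xt) / M.qbar * (M.q N - M.q (N - 1)) ∧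
        M.cost i - (M.cost i - xt) / M.qbar * (M.q 1 - M.q 0) < M.hi) →
      ContDiffOn ℝ 1 M.g (Set.Icc M.lo M.hi) →
      ∀ᶠ ε in 𝓝[>] (0 : ℝ), ∃ v : Fin N → ℝ, M.Implements ε v xt) := by
  have hX : xt ∈ Icc M.lo M.hi := Ioo_subset_Icc_self hxt
  have hlim : ∀ i, Tendsto (fun ε => M.indifferenceReward ε xt i) (𝓝[>] 0)
      (𝓝 ((M.cost i - xt) / M.qbar)) := fun i =>
    (M.tendsto_indifferenceReward xt i).mono_left nhdsWithin_le_nhds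
  refine ⟨fun δ hδ => ?_, fun ε hε v v' h h' => ?_, fun ε hε v h i j hc => ?_,
    fun hq hc hdom hg => ?_⟩
  · have h1 : ∀ᶠ ε in 𝓝[>] (0 : ℝ), ∀ i,
        |M.qbar * M.indifferenceReward ε xt i - (M.cost i - xt)| < δ := by
      refine eventually_all.2 fun i => ?_
      have h2 := (((hlim i).const_mul M.qbar).sub_const (M.cost i - xt)).abs
      rw [mul_div_cancel₀ _ (M.qbar_pos i.pos).ne', sub_self, abs_zero] at h2
      exact h2.eventually (gt_mem_nhds hδ)
    filter_upwards [h1, M.eventually_gain_eq_zero_iff hxt, self_mem_nhdsWithin]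
      with ε h1 h2 (hε : 0 < ε) v hv i
    rw [(h2 v i).1 (M.gain_switching_eq_zero hε hX hv.1 i)]
    exact h1 i
  · ext i
    exact M.reward_unique hε hX rfl (M.gain_switching_eq_zero hε hX h.1 i)
      (M.gain_switching_eq_zero hε hX h'.1 i)
  · exact M.reward_unique hε hX hc (M.gain_switching_eq_zero hε hX h.1 i)
      (M.gain_switching_eq_zero hε hX h.1 j)
  · have hagent : ∀ᶠ ε in 𝓝[>] (0 : ℝ), ∀ i,
        (∀ v : Fin N → ℝ, |v i| ≤ (M.cost i - xt) / M.qbar + 1 →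
          M.gain ε v (PrincipalAgent.switching N xt) i xt = 0 →
          ∀ X ∈ Icc (M.lo + ε / 2) (M.hi - ε / 2),
            (xt < X → 0 < M.gain ε v (PrincipalAgent.switching N X) i X) ∧
            (X < xt → M.gain ε v (PrincipalAgent.switching N X) i X < 0)) ∧
        0 < M.indifferenceReward ε xt i ∧
        M.indifferenceReward ε xt i < (M.cost i - xt) / M.qbar + 1 ∧
        0 < M.hi - ε - M.cost i + M.indifferenceReward ε xt i * M.marginal 0 ∧
        M.lo + ε - M.cost i + M.indifferenceReward ε xt i * M.marginal (N - 1) < 0 := by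
      refine eventually_all.2 fun i => ?_
      have hv0 : 0 < (M.cost i - xt) / M.qbar := div_pos (sub_pos.2 (hc i)) (M.qbar_pos i.pos)
      have hid : Tendsto (fun ε : ℝ => ε) (𝓝[>] 0) (𝓝 0) := nhdsWithin_le_nhds
      have hU := (((tendsto_const_nhds (x := M.hi)).sub hid).sub_const (M.cost i)).add
        ((hlim i).mul_const (M.marginal 0))
      have hL := (((tendsto_const_nhds (x := M.lo)).add hid).sub_const (M.cost i)).add
        ((hlim i).mul_const (M.marginal (N - 1)))
      have hmarg : M.marginal (N - 1) = M.q N - M.q (N - 1) := by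
        rw [PrincipalAgent.marginal, Nat.sub_add_cancel i.pos]
      have hmarg0 : M.marginal 0 = M.q 1 - M.q 0 := rfl
      exact (M.eventually_gain_switching_self_sign hg hxt i (by linarith)).and
        (((hlim i).eventually (lt_mem_nhds hv0)).and
        (((hlim i).eventually (gt_mem_nhds (lt_add_one _))).and
        ((hU.eventually (lt_mem_nhds (by rw [hmarg0]; linarith [(hdom i).2]))).and
        (hL.eventually (gt_mem_nhds (by rw [hmarg]; linarith [(hdom i).1]))))))
    have hsmall : ∀ᶠ ε in 𝓝[>] (0 : ℝ), ε < min (xt - M.lo) (M.hi - xt) :=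
      (gt_mem_nhds (lt_min (sub_pos.2 hxt.1) (sub_pos.2 hxt.2))).filter_mono nhdsWithin_le_nhds
    filter_upwards [hagent, M.eventually_gain_eq_zero_iff hxt, hsmall, self_mem_nhdsWithin]
      with ε hagent hzero hε1 (hε : 0 < ε)
    rw [lt_min_iff] at hε1
    have hY0 : ∀ i, M.gain ε (M.indifferenceReward ε xt) (PrincipalAgent.switching N xt) i xt = 0 :=
      fun i => (hzero _ i).2 rfl
    have hsign := fun i => (hagent i).1 (M.indifferenceReward ε xt)
      (by rw [abs_of_pos (hagent i).2.1]; exact (hagent i).2.2.1.le) (hY0 i)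
    exact ⟨M.indifferenceReward ε xt, M.implements_of_gain_sign hq hε (fun i => (hagent i).2.1.le)
      ⟨by linarith, by linarith⟩ (fun i => (hagent i).2.2.2.1) (fun i => (hagent i).2.2.2.2) hY0
      (fun i X hX => (hsign i X hX).1) (fun i X hX => (hsign i X hX).2)⟩
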